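/- **Setting.** Let $M$ be a connected smooth $n$-dimensional manifold with tangent bundle $\pi:TM\to M$. Let $U\subset TM\setminus\{0\}$ be a conic sub-bundle, i.e. a $2n$-dimensional submanifold (open, or with boundary) of the slit tangent bundle such that $\pi(U)=M$ and $\lambda u\in U$ whenever $u\in U$, $\lambda\neq 0$. Let $U$ be time oriented: $U=U^+\cup U^-$ is a disjoint union, $u\in U^+$ if and only if $-u\in U^-$, and the function equal to $1$ on $U^+$ and $-1$ on $U^-$ is smooth on $U$. For $h\in C^\infty(M)$ write $\dot h(u)=u\langle h\rangle$ for $u\in TM$. Let $\mathcal R$ be the radial vector field, $\mathcal R|_u=\frac{d}{dt}\big|_{t=1}(tu)$. A *kinematic domain* is a connected $(2n-1)$-dimensional submanifold $\Sigma_E:E\hookrightarrow U$ with $E\subset U^+$ and $\pi(E)=M$ such that every $u\in U$ is $u=\lambda v$ for a unique pair $v\in E$, $\lambda\neq0$, and such that $E$ is a hypersurface of $U$ transverse to $\mathcal R$: near each of its points $E$ is the zero set in $U$ of a smooth function $F$ with $\mathcal R\langle F\rangle\ne0$ at that point. A *Vlasov field on $E$* is a smooth vector field $W_E$ on $E$ with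 $\pi_*(W_E|_v)=v$. A *Vlasov field on $U$* is a smooth vector field $W$ on $U$ with $\pi_*(W|_u)=u$ and $W\langle\dot h\rangle|_{\lambda u}=\lambda^2W\langle\dot h\rangle|_u$ for all $h\in C^\infty(M)$, $u\in U$, $\lambda>0$; it is an *extension* of $W_E$ if $\Sigma_{E*}(W_E|_v)=W|_{\Sigma_E(v)}$ for all $v\in E$. **Lemma.** Let $E$ be a kinematic domain, $W_E$ a Vlasov field on $E$ and $\theta_E$ a smooth $(2n-2)$-form on $E$ satisfying the transport equations on $E$, $d\theta_E=0$ and $i_{W_E}\theta_E=0$. Let $\Pi:U^+\to E$ be the radial projection, $\Pi(\lambda v)=v$ for $v\in E$, $\lambda>0$. Let $\theta$ be the future-pointing form on $U$ given by $\theta|_{U^+}=\Pi^*\theta_E$ and $\theta|_{U^-}=0$. Let the Vlasov field $W$ on $U$ be an extension of $W_E$, and put $\Psi=\mathcal R\wedge W$. Then $\theta$ is a smooth $(2n-2)$-form on $U$, $\Psi$ is a Vlasov bivector (a simple smooth bivector field of the form $\mathcal R\wedge W'$ with $W'$ a Vlasov field on $U$), and $(\Psi,\theta)$ satisfies the transport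 equations on $U$: $d\theta=0$, and $\mathrm{Null}(\Psi,\theta)$ holds, that is, $i_X\theta=0$ and $i_Y\theta=0$ for all smooth vector fields $X,Y$ on $U$ with $\Psi=X\wedge Y$ (in particular $i_{\mathcal R}\theta=0$ and $i_W\theta=0$). -/

import Mathlib

open Set Topology Manifold
open scoped ContDiff

namespace Vlasov

noncomputable section

section Forms

variable {G : Type*} [NormedAddCommGroup G] [NormedSpace ℝ G]
  {H : Type*} [TopologicalSpace H] (J : ModelWithCorners ℝ G H)
  {N : Type*} [TopologicalSpace N] [ChartedSpace H N]

/-- A (not necessarily smooth) vector field on the manifold `N`. -/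
abbrev VField (_J : ModelWithCorners ℝ G H) (N : Type*) [TopologicalSpace N] [ChartedSpace H N] :
    Type _ :=
  ∀ x : N, TangentSpace _J x

/-- A (not necessarily smooth) differential form of degree `k` on the manifold `N`. -/
abbrev DForm (_J : ModelWithCorners ℝ G H) (N : Type*) [TopologicalSpace N] [ChartedSpace H N]
    (k : ℕ) : Type _ :=
  ∀ x : N, TangentSpace _J x [⋀^Fin k]→L[ℝ] ℝ

/-- The vector field `X` is smooth on the set `S`. -/
def SmoothField [IsManifold J 1 N] (S : Set N) (X : VField J N) : Prop :=
  ContMDiffOn J J.tangent ∞ (fun x => (⟨x, X x⟩ : TangentBundle J N)) S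

/-- The coordinate expression of the form `α` in the preferred chart `φ` at `x₀`: the pullback
`(φ⁻¹)^* α`, a form on the model vector space. -/
def coordForm {k : ℕ} (α : DForm J N k) (x₀ : N) (y : G) : G [⋀^Fin k]→L[ℝ] ℝ :=
  (α ((extChartAt J x₀).symm y)).compContinuousLinearMap
    (mfderivWithin 𝓘(ℝ, G) J (extChartAt J x₀).symm (range J) y)

/-- The form `α` is smooth on the set `S`: its coordinate expressions are smooth. -/
def SmoothForm {k : ℕ} (S : Set N) (α : DForm J N k) : Prop :=
  ∀ x₀ : N, ContDiffOn ℝ ∞ (coordForm J α x₀)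
    ((extChartAt J x₀).target ∩ (extChartAt J x₀).symm ⁻¹' S)

/-- The exterior derivative at `x` of the form `α` on the subset `S` of `N`, computed in
the preferred chart at `x`. It is used for open sets and for full-dimensional subsets with boundary;
at boundary points the derivative is taken within the set. -/
def extD {k : ℕ} (S : Set N) (α : DForm J N k) : DForm J N (k + 1) := fun x =>
  (extDerivWithin (coordForm J α x) ((extChartAt J x).symm ⁻¹' S ∩ range J)
    (extChartAt J x x)).compContinuousLinearMap (mfderiv J 𝓘(ℝ, G) (extChartAt J x) x)

end Forms

/-- The interior product `i_X α`; it vanishes on forms of degree zero. -/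
def interiorProd {V : Type*} [AddCommGroup V] [Module ℝ V] [TopologicalSpace V] (X : V) :
    {k : ℕ} → (α : V [⋀^Fin k]→L[ℝ] ℝ) → V [⋀^Fin (k - 1)]→ₗ[ℝ] ℝ
  | 0, _ => 0
  | _ + 1, α => α.toAlternatingMap.curryLeft X

section Conic

variable {n : ℕ} {M : Type*} [TopologicalSpace M] [ChartedSpace (EuclideanSpace ℝ (Fin n)) M]

/-- Fibrewise multiplication by `t` on the tangent bundle. -/
def scale (t : ℝ) (u : TangentBundle (𝓡 n) M) : TangentBundle (𝓡 n) M := ⟨u.proj, t • u.snd⟩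

/-- The scalar lift `ḣ(u) = u⟨h⟩` of a function `h` on `M`. -/
def scalarLift (h : M → ℝ) (u : TangentBundle (𝓡 n) M) : ℝ :=
  mfderiv (𝓡 n) 𝓘(ℝ, ℝ) h u.proj u.snd

variable [IsManifold (𝓡 n) ∞ M]

/-- The radial vector field: its value at `u` is the velocity at `t = 1` of `t ↦ t u`. -/
def radialField : VField (𝓡 n).tangent (TangentBundle (𝓡 n) M) := fun u =>
  mfderiv 𝓘(ℝ, ℝ) (𝓡 n).tangent (fun t : ℝ => scale t u) 1 (1 : ℝ)

/-- The derivative `X⟨F⟩` of the function `F` on `TM` along the vector `X` at `u`. -/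
def dirDeriv (F : TangentBundle (𝓡 n) M → ℝ) (u : TangentBundle (𝓡 n) M)
    (X : TangentSpace (𝓡 n).tangent u) : ℝ :=
  mfderiv (𝓡 n).tangent 𝓘(ℝ, ℝ) F u X

/-- A conic sub-bundle of the slit tangent bundle. The two regularity conditions hold for open
sets and for full-dimensional submanifolds with boundary; under them the tangent space of `U`
at each of its points is the whole tangent space of `TM`. -/
structure IsConicSubbundle (U : Set (TangentBundle (𝓡 n) M)) : Prop where
  slit : ∀ u ∈ U, u.snd ≠ 0
  proj_surj : ∀ p : M, ∃ u ∈ U, u.proj = p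
  conic : ∀ u ∈ U, ∀ t : ℝ, t ≠ 0 → scale t u ∈ U
  uniqueDiff : UniqueMDiffOn (𝓡 n).tangent U
  subset_closure_interior : U ⊆ closure (interior U)

open Classical in
/-- The causal indicator: `1` on future pointing vectors and `-1` on the others. -/
def causalIndicator (Up : Set (TangentBundle (𝓡 n) M)) (u : TangentBundle (𝓡 n) M) : ℝ :=
  if u ∈ Up then 1 else -1

/-- A time orientation `U = U⁺ ∪ U⁻`; the causal indicator is a scalar field,
that is, a smooth function, on `U`. -/
structure IsTimeOrientation (U Up Um : Set (TangentBundle (𝓡 n) M)) : Prop where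
  union_eq : U = Up ∪ Um
  disj : Disjoint Up Um
  neg_iff : ∀ u, u ∈ Up ↔ scale (-1) u ∈ Um
  smooth_indicator : ContMDiffOn (𝓡 n).tangent 𝓘(ℝ, ℝ) ∞ (causalIndicator Up) U

/-- A Vlasov field on `U`: smooth, horizontal and radially quadratic. -/
structure IsVlasovField (U : Set (TangentBundle (𝓡 n) M))
    (W : VField (𝓡 n).tangent (TangentBundle (𝓡 n) M)) : Prop where
  smooth : SmoothField (𝓡 n).tangent U W
  horizontal : ∀ u ∈ U,
    mfderiv (𝓡 n).tangent (𝓡 n) (Bundle.TotalSpace.proj : TangentBundle (𝓡 n) M → M) u (W u)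
      = u.snd
  quadratic : ∀ h : M → ℝ, ContMDiff (𝓡 n) 𝓘(ℝ, ℝ) ∞ h → ∀ u ∈ U, ∀ t : ℝ, 0 < t →
    dirDeriv (scalarLift h) (scale t u) (W (scale t u)) = t ^ 2 * dirDeriv (scalarLift h) u (W u)

/-- Bivector fields. -/
abbrev BivField (n : ℕ) (M : Type*) [TopologicalSpace M]
    [ChartedSpace (EuclideanSpace ℝ (Fin n)) M] [IsManifold (𝓡 n) ∞ M] : Type _ :=
  ∀ u : TangentBundle (𝓡 n) M, ⋀[ℝ]^2 (TangentSpace (𝓡 n).tangent u)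

/-- The bivector field `X ∧ Y`. -/
def wedge (X Y : VField (𝓡 n).tangent (TangentBundle (𝓡 n) M)) : BivField n M := fun u =>
  exteriorPower.ιMulti ℝ 2 ![X u, Y u]

/-- `Φ = X ∧ Y` on `U` for two smooth vector fields on `U`. -/
def Represents (U : Set (TangentBundle (𝓡 n) M)) (Φ : BivField n M)
    (X Y : VField (𝓡 n).tangent (TangentBundle (𝓡 n) M)) : Prop :=
  SmoothField (𝓡 n).tangent U X ∧ SmoothField (𝓡 n).tangent U Y ∧
    ∀ u ∈ U, Φ u = wedge X Y u

/-- A Vlasov bivector on `U`: a simple bivector of the form `R ∧ W` with `R` the radial field and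
`W` a Vlasov field. Such a bivector is radial and horizontal because `W` is horizontal. -/
structure IsVlasovBivector (U : Set (TangentBundle (𝓡 n) M)) (Ψ : BivField n M) : Prop where
  simple : ∃ X Y, Represents U Ψ X Y
  eq_wedge : ∃ W, IsVlasovField U W ∧ ∀ u ∈ U, Ψ u = wedge radialField W u

/-- The null condition `Null(Φ, α)` on `U`. -/
def NullCondition (U : Set (TangentBundle (𝓡 n) M)) (Φ : BivField n M) {k : ℕ}
    (α : DForm (𝓡 n).tangent (TangentBundle (𝓡 n) M) k) : Prop :=
  ∀ X Y, Represents U Φ X Y →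
    ∀ u ∈ U, interiorProd (X u) (α u) = 0 ∧ interiorProd (Y u) (α u) = 0

/-- `Ψ` is a Vlasov bivector, `θ` is a smooth form of degree `2n - 2`, and the pair satisfies the
transport equations on `U`: `Null(Ψ, θ)` and `dθ = 0`. -/
structure TransportOnU (U : Set (TangentBundle (𝓡 n) M)) (Ψ : BivField n M)
    (θ : DForm (𝓡 n).tangent (TangentBundle (𝓡 n) M) (2 * n - 2)) : Prop where
  vlasov : IsVlasovBivector U Ψ
  smooth : SmoothForm (𝓡 n).tangent U θ
  null : NullCondition U Ψ θ
  closed : ∀ u ∈ U, extD (𝓡 n).tangent U θ u = 0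

section Domain

variable {H : Type*} [TopologicalSpace H]
  {J : ModelWithCorners ℝ (EuclideanSpace ℝ (Fin (2 * n - 1))) H}
  {E : Type*} [TopologicalSpace E] [ChartedSpace H E]

variable (J) in
/-- The `(2n-1)`-dimensional manifold `E` (with boundary if `U` has one), with the inclusion
`ιE : E → TM`, is a kinematic domain in `U`. By `hypersurface`, near each of its points `E` is cut
out of `U` by one smooth equation `F = 0` with `R⟨F⟩ ≠ 0`, that is, `E` is a hypersurface of `U`
transverse to the radial field. -/
structure IsKinematicDomain (U Up : Set (TangentBundle (𝓡 n) M))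
    (ιE : E → TangentBundle (𝓡 n) M) : Prop where
  embedding : IsSmoothEmbedding J (𝓡 n).tangent ∞ ιE
  mem_future : ∀ v, ιE v ∈ Up
  proj_surj : Function.Surjective fun v => (ιE v).proj
  connected : ConnectedSpace E
  ray : ∀ u ∈ U, ∃! q : E × ℝ, q.2 ≠ 0 ∧ u = scale q.2 (ιE q.1)
  hypersurface : ∀ v, ∃ O : Set (TangentBundle (𝓡 n) M), IsOpen O ∧ ιE v ∈ O ∧
    ∃ F : TangentBundle (𝓡 n) M → ℝ, ContMDiffOn (𝓡 n).tangent 𝓘(ℝ, ℝ) ∞ F O ∧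
      range ιE ∩ O = {u ∈ U ∩ O | F u = 0} ∧
      dirDeriv F (ιE v) (radialField (ιE v)) ≠ 0

variable [IsManifold J ∞ E]

/-- A Vlasov field on the kinematic domain `E`: smooth and horizontal. -/
structure IsVlasovFieldOnE (ιE : E → TangentBundle (𝓡 n) M) (WE : VField J E) : Prop where
  smooth : SmoothField J univ WE
  horizontal : ∀ v, mfderiv J (𝓡 n) (fun v' => (ιE v').proj) v (WE v) = (ιE v).snd

/-- The transport equations on `E` for the smooth `(2n-2)`-form `θE` and the field `WE`. -/
structure TransportOnE (WE : VField J E) (θE : DForm J E (2 * n - 2)) : Prop where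
  smooth : SmoothForm J univ θE
  closed : ∀ v, extD J univ θE v = 0
  tangent : ∀ v, interiorProd (WE v) (θE v) = 0

/-- The Vlasov field `W` on `U` is an extension of `WE`: it is tangent to `E` and induces `WE`. -/
structure IsExtension (U : Set (TangentBundle (𝓡 n) M)) (ιE : E → TangentBundle (𝓡 n) M)
    (WE : VField J E) (W : VField (𝓡 n).tangent (TangentBundle (𝓡 n) M)) : Prop where
  vlasov : IsVlasovField U W
  induced : ∀ v, mfderiv J (𝓡 n).tangent ιE v (WE v) = W (ιE v)

/-- The radial projection `Π : U⁺ → E`, `Π(t v) = v` for `t > 0` (with arbitrary values at vectors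
that are not on a positive ray through `E`). -/
def radialProj [Nonempty E] (ιE : E → TangentBundle (𝓡 n) M) (u : TangentBundle (𝓡 n) M) : E :=
  Classical.epsilon fun v => ∃ t : ℝ, 0 < t ∧ u = scale t (ιE v)

open Classical in
/-- The future pointing form `θ` with `θ = Π^* θE` on `U⁺` and `θ = 0` on `U⁻`. -/
def futureForm [Nonempty E] (Up : Set (TangentBundle (𝓡 n) M)) (ιE : E → TangentBundle (𝓡 n) M)
    {k : ℕ} (θE : DForm J E k) : DForm (𝓡 n).tangent (TangentBundle (𝓡 n) M) k := fun u =>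
  if u ∈ Up then
    (θE (radialProj ιE u)).compContinuousLinearMap
      (mfderivWithin (𝓡 n).tangent J (radialProj ιE) Up u)
  else 0

end Domain

end Conic

end

end Vlasov

/-! On U⁺ the form θ is a pullback along the radial projection Π, so the transport equations on U
reduce to those on E once Π is known to be smooth. Pullback commutes with d, hence dθ = Π^*dθ_E = 0.
Since i_X Π^*θ_E = Π^*(i_{dΠ X} θ_E), only dΠ(R) and dΠ(W) are needed. The first is zero because Π
is constant on rays. The second, at tv with v in E and t > 0, is t W_E(v): Π ∘ (multiplication by t)
is the identity on E, and W(tv) is t times the image of W(v) under multiplication by t.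

This homogeneity (`IsVlasovField.scale_eq`) follows from the definition of a Vlasov field because a
tangent vector of TM is determined by its projection to M and its action on scalar lifts
(`eq_zero_of_dirDeriv_scalarLift`). The smoothness of Π (`contMDiffWithinAt_radialProj`) comes from
the implicit function theorem applied to F(su) = 0, with R⟨F⟩ ≠ 0 as the nondegeneracy condition.

On U⁻ the form is zero. The two pieces glue because U⁺ and U⁻ are relatively open in U, the
indicator being continuous. Finally, R and W are linearly independent off the zero section, so any
X, Y with X ∧ Y = R ∧ W lie pointwise in their span and also annihilate θ.

Since U may have a boundary, derivatives are taken within sets. Unique differentiability makes them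
well defined, and density of the interior gives the symmetry of second derivatives behind d ∘ Π^* =
Π^* ∘ d. -/

namespace Vlasov

noncomputable section

/-! ### Smooth dependence of pulled-back alternating forms -/

section AlternatingSmooth

variable {V V' : Type*} [NormedAddCommGroup V] [NormedSpace ℝ V]
  [NormedAddCommGroup V'] [NormedSpace ℝ V']

/-- Antisymmetrization of multilinear forms, as a continuous linear map. It is a left inverse of
the inclusion of the alternating forms. -/
def antisymmetrization (V : Type*) [NormedAddCommGroup V] [NormedSpace ℝ V] (k : ℕ) :
    ContinuousMultilinearMap ℝ (fun _ : Fin k => V) ℝ →L[ℝ] V [⋀^Fin k]→L[ℝ] ℝ :=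
  LinearMap.mkContinuous
    { toFun := fun f => ((k.factorial : ℝ)⁻¹) • ContinuousMultilinearMap.alternatization f
      map_add' := fun f g => by rw [map_add, smul_add]
      map_smul' := fun c f => by
        ext v
        simp only [ContinuousAlternatingMap.smul_apply,
          ContinuousMultilinearMap.alternatization_apply_apply,
          _root_.smul_apply, RingHom.id_apply, Finset.smul_sum]
        exact Finset.sum_congr rfl fun σ _ => by
          rw [smul_comm _ c, smul_comm _ c] } 1 (fun f => by
    refine ContinuousAlternatingMap.opNorm_le_bound _ (by positivity) fun v => ?_
    have hk : (0 : ℝ) < k.factorial := by exact_mod_cast k.factorial_pos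
    simp only [LinearMap.coe_mk, AddHom.coe_mk, ContinuousAlternatingMap.smul_apply,
      ContinuousMultilinearMap.alternatization_apply_apply, norm_smul, norm_inv,
      Real.norm_natCast, one_mul]
    rw [inv_mul_le_iff₀ hk]
    refine (norm_sum_le _ _).trans ?_
    have : ∀ σ ∈ (Finset.univ : Finset (Equiv.Perm (Fin k))),
        ‖Equiv.Perm.sign σ • f (v ∘ σ)‖ ≤ ‖f‖ * ∏ i, ‖v i‖ := by
      intro σ _
      have h1 : ‖Equiv.Perm.sign σ • f (v ∘ σ)‖ = ‖f (v ∘ σ)‖ := by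
        rcases Int.units_eq_one_or (Equiv.Perm.sign σ) with h | h <;> simp [h]
      rw [h1, ← Equiv.prod_comp σ (fun i => ‖v i‖)]
      exact f.le_opNorm _
    refine (Finset.sum_le_sum this).trans ?_
    simp [Fintype.card_perm])

lemma antisymmetrization_toContinuousMultilinearMap {k : ℕ} (η : V [⋀^Fin k]→L[ℝ] ℝ) :
    antisymmetrization V k η.toContinuousMultilinearMap = η := by
  ext v
  have hk : (k.factorial : ℝ) ≠ 0 := by exact_mod_cast k.factorial_ne_zero
  have : ∀ σ : Equiv.Perm (Fin k), Equiv.Perm.sign σ • η (v ∘ σ) = η v := by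
    intro σ
    have h := η.toAlternatingMap.map_perm v σ
    simp only [ContinuousAlternatingMap.coe_toAlternatingMap] at h
    rw [h, smul_smul, Int.units_mul_self, one_smul]
  change (k.factorial : ℝ)⁻¹ • ContinuousMultilinearMap.alternatization
    η.toContinuousMultilinearMap v = _
  rw [ContinuousMultilinearMap.alternatization_apply_apply]
  simp only [ContinuousAlternatingMap.coe_toContinuousMultilinearMap, this]
  simp [Fintype.card_perm, hk]

/-- For multilinear forms, precomposition is continuous multilinear in the linear maps, hence
smooth. Antisymmetrization, a left inverse of the inclusion, carries this over to alternating forms.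
-/
lemma contDiffOn_compContinuousLinearMap {B : Type*} [NormedAddCommGroup B] [NormedSpace ℝ B]
    {k : ℕ} {r : WithTop ℕ∞} {η : B → V' [⋀^Fin k]→L[ℝ] ℝ} {L : B → V →L[ℝ] V'} {s : Set B}
    (hη : ContDiffOn ℝ r η s) (hL : ContDiffOn ℝ r L s) :
    ContDiffOn ℝ r (fun y => (η y).compContinuousLinearMap (L y)) s := by
  let T : (V' [⋀^Fin k]→L[ℝ] ℝ) →L[ℝ] ContinuousMultilinearMap ℝ (fun _ : Fin k => V') ℝ :=
    ContinuousAlternatingMap.toContinuousMultilinearMapCLM ℝ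
  have h1 : ContDiffOn ℝ r (fun y => T (η y)) s := T.contDiff.comp_contDiffOn hη
  have h2 : ContDiffOn ℝ r (fun y =>
      ContinuousMultilinearMap.compContinuousLinearMapContinuousMultilinear ℝ
        (fun _ : Fin k => V) (fun _ => V') ℝ (fun _ => L y)) s :=
    (ContinuousMultilinearMap.contDiff _).comp_contDiffOn (contDiffOn_pi.2 fun _ => hL)
  have h3 := (antisymmetrization V k).contDiff.comp_contDiffOn (h2.clm_apply h1)
  refine h3.congr fun y _ => ?_
  exact (antisymmetrization_toContinuousMultilinearMap
    ((η y).compContinuousLinearMap (L y))).symm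

end AlternatingSmooth

/-! ### Pullback of forms: smoothness and closedness -/

section Pullback

variable {G : Type*} [NormedAddCommGroup G] [NormedSpace ℝ G]
  {H : Type*} [TopologicalSpace H] {I : ModelWithCorners ℝ G H}
  {N : Type*} [TopologicalSpace N] [ChartedSpace H N]
  {G' : Type*} [NormedAddCommGroup G'] [NormedSpace ℝ G']
  {H' : Type*} [TopologicalSpace H'] {J : ModelWithCorners ℝ G' H'}
  {P : Type*} [TopologicalSpace P] [ChartedSpace H' P]

/-- The pullback of the form `α` on `P` along the restriction of `f : N → P` to the set `S`. -/
def pullbackForm (I : ModelWithCorners ℝ G H) (S : Set N) (f : N → P) {k : ℕ}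
    (α : DForm J P k) : DForm I N k := fun x =>
  (α (f x)).compContinuousLinearMap (mfderivWithin I J f S x)

/-- The domain of the expression of `f`, restricted to `S`, in the charts at `x₀` and `p₀`. -/
def chartDomain (I : ModelWithCorners ℝ G H) (J : ModelWithCorners ℝ G' H') (S : Set N)
    (f : N → P) (x₀ : N) (p₀ : P) : Set G :=
  (extChartAt I x₀).target ∩ (extChartAt I x₀).symm ⁻¹' (S ∩ f ⁻¹' (extChartAt J p₀).source)

/-- The expression of `f` in the charts at `x₀` and `p₀`. -/
def chartExpr (I : ModelWithCorners ℝ G H) (J : ModelWithCorners ℝ G' H')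
    (f : N → P) (x₀ : N) (p₀ : P) (y : G) : G' :=
  extChartAt J p₀ (f ((extChartAt I x₀).symm y))

lemma chartExpr_mapsTo (S : Set N) (f : N → P) (x₀ : N) (p₀ : P) :
    MapsTo (chartExpr I J f x₀ p₀) (chartDomain I J S f x₀ p₀) (extChartAt J p₀).target :=
  fun _ hy => (extChartAt J p₀).map_source hy.2.2

/-- Allows derivatives within the full chart image of S to be computed within the smaller domain
where the target chart is also valid. -/
lemma chartDomain_mem_nhdsWithin {S : Set N} {f : N → P} (hf : ContinuousOn f S) {x₀ : N} {p₀ : P}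
    {y : G} (hy : y ∈ chartDomain I J S f x₀ p₀) :
    chartDomain I J S f x₀ p₀ ∈ 𝓝[(extChartAt I x₀).symm ⁻¹' S ∩ range I] y := by
  have h1 : (extChartAt I x₀).target ∈ 𝓝[(extChartAt I x₀).symm ⁻¹' S ∩ range I] y :=
    nhdsWithin_mono _ inter_subset_right (extChartAt_target_mem_nhdsWithin_of_mem hy.1)
  have h2 : f ⁻¹' (extChartAt J p₀).source ∈ 𝓝[S] ((extChartAt I x₀).symm y) :=
    (hf _ hy.2.1).preimage_mem_nhdsWithin ((isOpen_extChartAt_source p₀).mem_nhds hy.2.2)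
  have h3 : ContinuousWithinAt (extChartAt I x₀).symm
      ((extChartAt I x₀).symm ⁻¹' S ∩ range I) y :=
    ((contMDiffWithinAt_extChartAt_symm_range (n := 0) x₀ hy.1).continuousWithinAt).mono
      inter_subset_right
  have h4 := (h3.tendsto_nhdsWithin (t := S) (fun z hz => hz.1)) h2
  filter_upwards [h1, h4, self_mem_nhdsWithin] with z hz1 hz2 hz3
  exact ⟨hz1, hz3.1, hz2⟩

variable [IsManifold I ∞ N] [IsManifold J ∞ P]

lemma contDiffOn_chartExpr {S : Set N} {f : N → P} (hf : ContMDiffOn I J ∞ f S) (x₀ : N) (p₀ : P) :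
    ContDiffOn ℝ ∞ (chartExpr I J f x₀ p₀) (chartDomain I J S f x₀ p₀) :=
  (contMDiffOn_iff.1 hf).2 x₀ p₀

omit [IsManifold J ∞ P] in
lemma uniqueDiffOn_chartDomain {S : Set N} (hS : UniqueMDiffOn I S) {f : N → P}
    (hf : ContinuousOn f S) (x₀ : N) (p₀ : P) : UniqueDiffOn ℝ (chartDomain I J S f x₀ p₀) :=
  have : IsManifold I 1 N := IsManifold.of_le (n := ∞) (by simp)
  hS.uniqueDiffOn_inter_preimage x₀ p₀ hf

/-- With charts φ, ψ and g the expression of f, the maps f ∘ φ⁻¹ and ψ⁻¹ ∘ g agree on the chart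
domain. The chain rule differentiates both, and unique differentiability identifies the results. -/
lemma coordForm_pullbackForm {S : Set N} (hS : UniqueMDiffOn I S) {f : N → P}
    (hf : ContMDiffOn I J ∞ f S) {k : ℕ} (α : DForm J P k) (x₀ : N) (p₀ : P) {y : G}
    (hy : y ∈ chartDomain I J S f x₀ p₀) :
    coordForm I (pullbackForm I S f α) x₀ y =
      (coordForm J α p₀ (chartExpr I J f x₀ p₀ y)).compContinuousLinearMap
        (fderivWithin ℝ (chartExpr I J f x₀ p₀) (chartDomain I J S f x₀ p₀) y) := by
  have : IsManifold I 1 N := IsManifold.of_le (n := ∞) (by simp)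
  have : IsManifold J 1 P := IsManifold.of_le (n := ∞) (by simp)
  set g := chartExpr I J f x₀ p₀ with hg
  set T := chartDomain I J S f x₀ p₀ with hT
  have hTu : UniqueMDiffWithinAt 𝓘(ℝ, G) T y :=
    (uniqueDiffOn_chartDomain hS hf.continuousOn x₀ p₀ y hy).uniqueMDiffWithinAt
  have hgy : g y ∈ (extChartAt J p₀).target := chartExpr_mapsTo S f x₀ p₀ hy
  have hsymm : (extChartAt J p₀).symm (g y) = f ((extChartAt I x₀).symm y) :=
    (extChartAt J p₀).left_inv hy.2.2
  have hg' : HasMFDerivWithinAt 𝓘(ℝ, G) 𝓘(ℝ, G') g T y (fderivWithin ℝ g T y) :=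
    (((contDiffOn_chartExpr hf x₀ p₀ y hy).differentiableWithinAt
      (by simp)).hasFDerivWithinAt).hasMFDerivWithinAt
  have hψ := (mdifferentiableWithinAt_extChartAt_symm hgy).hasMFDerivWithinAt
  have h1 := hψ.comp y hg' (fun z hz => extChartAt_target_subset_range p₀
    (chartExpr_mapsTo S f x₀ p₀ hz))
  have hφ := (mdifferentiableWithinAt_extChartAt_symm hy.1).hasMFDerivWithinAt
  have hTr : T ⊆ range I := fun z hz => extChartAt_target_subset_range x₀ hz.1
  have hφ' := hφ.mono hTr
  have hff := ((hf _ hy.2.1).mdifferentiableWithinAt (by simp)).hasMFDerivWithinAt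
  have h2 := hff.comp y hφ' (fun z hz => hz.2.1)
  have h3 := h2.congr_of_eventuallyEq (f₁ := (extChartAt J p₀).symm ∘ g)
    (by filter_upwards [self_mem_nhdsWithin] with z hz
        exact (extChartAt J p₀).left_inv hz.2.2) hsymm
  have h4 := hTu.eq h1 h3
  -- All tangent spaces of `P` are the model space by definition; erasing the dependence on the
  -- point allows a rewrite along `hsymm`.
  let A : P → G' [⋀^Fin k]→L[ℝ] ℝ := α
  have hA : A ((extChartAt J p₀).symm (g y)) = A (f ((extChartAt I x₀).symm y)) :=
    congrArg A hsymm
  ext v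
  change A (f ((extChartAt I x₀).symm y)) _ = A ((extChartAt J p₀).symm (g y)) _
  rw [hA]
  congr 1
  funext i
  exact (DFunLike.congr_fun h4 (v i)).symm

/-- The pullback of a smooth form along a map that is smooth on `S` is smooth on `S`. -/
lemma smoothForm_pullbackForm {S : Set N} (hS : UniqueMDiffOn I S) {f : N → P}
    (hf : ContMDiffOn I J ∞ f S) {k : ℕ} {α : DForm J P k} (hα : SmoothForm J univ α) :
    SmoothForm I S (pullbackForm I S f α) := by
  intro x₀ y hy
  set p₀ := f ((extChartAt I x₀).symm y)
  have hyT : y ∈ chartDomain I J S f x₀ p₀ := ⟨hy.1, hy.2, mem_extChartAt_source p₀⟩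
  have hT := uniqueDiffOn_chartDomain (J := J) hS hf.continuousOn x₀ p₀
  have hg := contDiffOn_chartExpr hf x₀ p₀
  have h1 : ContDiffOn ℝ ∞ (fun z => coordForm J α p₀ (chartExpr I J f x₀ p₀ z))
      (chartDomain I J S f x₀ p₀) :=
    (hα p₀).comp hg (fun z hz => ⟨chartExpr_mapsTo S f x₀ p₀ hz, mem_univ _⟩)
  have h2 : ContDiffOn ℝ ∞
      (fderivWithin ℝ (chartExpr I J f x₀ p₀) (chartDomain I J S f x₀ p₀))
      (chartDomain I J S f x₀ p₀) := hg.fderivWithin hT (by simp)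
  have h3 : ContDiffOn ℝ ∞ (coordForm I (pullbackForm I S f α) x₀)
      (chartDomain I J S f x₀ p₀) :=
    ContDiffOn.congr (contDiffOn_compContinuousLinearMap h1 h2)
      (fun z hz => coordForm_pullbackForm hS hf α x₀ p₀ hz)
  refine (h3 y hyT).mono_of_mem_nhdsWithin ?_
  refine nhdsWithin_mono _ ?_ (chartDomain_mem_nhdsWithin hf.continuousOn hyT)
  exact fun z hz => ⟨hz.2, extChartAt_target_subset_range x₀ hz.1⟩

omit [IsManifold I ∞ N] in
/-- The exterior derivative at `x` depends only on the germs at `x` of the set and the form. -/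
lemma extD_congr {S S' : Set N} {k : ℕ} {α β : DForm I N k} {x : N} (hx : x ∈ S)
    (hS : S =ᶠ[𝓝 x] S') (h : ∀ᶠ z in 𝓝[S] x, α z = β z) :
    extD I S α x = extD I S' β x := by
  have hc : Filter.Tendsto (extChartAt I x).symm (𝓝 (extChartAt I x x)) (𝓝 x) := by
    have := continuousAt_extChartAt_symm (I := I) x
    rwa [ContinuousAt, extChartAt_to_inv] at this
  have hset : ((extChartAt I x).symm ⁻¹' S ∩ range I : Set G) =ᶠ[𝓝 (extChartAt I x x)]
      ((extChartAt I x).symm ⁻¹' S' ∩ range I : Set G) := by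
    filter_upwards [hc hS] with z hz
    have hz' : ((extChartAt I x).symm z ∈ S) = ((extChartAt I x).symm z ∈ S') := hz
    change (_ ∧ _) = (_ ∧ _)
    simp only [mem_preimage, hz']
  have hmem : extChartAt I x x ∈ (extChartAt I x).symm ⁻¹' S ∩ range I :=
    ⟨by rwa [mem_preimage, extChartAt_to_inv], extChartAt_target_subset_range x (mem_extChartAt_target x)⟩
  have hform : coordForm I α x =ᶠ[𝓝[(extChartAt I x).symm ⁻¹' S ∩ range I] (extChartAt I x x)]
      coordForm I β x := by
    have : Filter.Tendsto (extChartAt I x).symm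
        (𝓝[(extChartAt I x).symm ⁻¹' S ∩ range I] (extChartAt I x x)) (𝓝[S] x) :=
      tendsto_nhdsWithin_iff.2 ⟨hc.mono_left nhdsWithin_le_nhds,
        by filter_upwards [self_mem_nhdsWithin] with z hz using hz.1⟩
    filter_upwards [this h] with z hz
    have hz' : α ((extChartAt I x).symm z) = β ((extChartAt I x).symm z) := hz
    rw [coordForm, coordForm, hz']
  rw [extD, extD, hform.extDerivWithin_eq_of_mem hmem, extDerivWithin, extDerivWithin,
    fderivWithin_congr_set hset]

/-- The pullback of a closed form along a map that is smooth on `S` is closed. -/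
lemma extD_pullbackForm_eq_zero [I.Boundaryless] {S : Set N} (hS : UniqueMDiffOn I S)
    (hSc : S ⊆ closure (interior S)) {f : N → P}
    (hf : ContMDiffOn I J ∞ f S) {k : ℕ} {α : DForm J P k} (hα : SmoothForm J univ α)
    {x : N} (hx : x ∈ S) (hd : extD J univ α (f x) = 0) :
    extD I S (pullbackForm I S f α) x = 0 := by
  have : IsManifold I 1 N := IsManifold.of_le (n := ∞) (by simp)
  have : IsManifold J 1 P := IsManifold.of_le (n := ∞) (by simp)
  set y := extChartAt I x x
  set p := f x
  have hyT : y ∈ chartDomain I J S f x p := by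
    refine ⟨mem_extChartAt_target x, ?_⟩
    simp only [mem_preimage, y, extChartAt_to_inv]
    exact ⟨hx, mem_extChartAt_source p⟩
  have hgy : chartExpr I J f x p y = extChartAt J p p := by
    simp only [chartExpr, y, extChartAt_to_inv, p]
  have hT := uniqueDiffOn_chartDomain (J := J) hS hf.continuousOn x p
  have hg := contDiffOn_chartExpr hf x p
  have hzero : extDerivWithin (coordForm J α p) (range J) (chartExpr I J f x p y) = 0 := by
    rw [hgy]
    -- `extD` is the coordinate exterior derivative composed with the derivative of the chart; since
    -- the latter is invertible, the coordinate derivative itself vanishes.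
    have hinv := isInvertible_mfderiv_extChartAt (I := J) (mem_extChartAt_source (I := J) p)
    obtain ⟨e, he⟩ := hinv
    simp only [extD, preimage_univ, univ_inter, ← he] at hd
    ext v
    have h0 : extDerivWithin (coordForm J α p) (range J) (extChartAt J p p)
        (fun i => e (e.symm (v i))) = 0 := DFunLike.congr_fun hd (fun i => e.symm (v i))
    have h1 : (fun i => e (e.symm (v i))) = v := funext fun i => e.apply_symm_apply (v i)
    exact h1 ▸ h0
  have hd1 : DifferentiableWithinAt ℝ (coordForm J α p) (range J) (chartExpr I J f x p y) := by
    have h1 := (hα p _ ⟨chartExpr_mapsTo S f x p hyT, mem_univ _⟩).differentiableWithinAt (by simp)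
    refine h1.mono_of_mem_nhdsWithin ?_
    rw [preimage_univ, inter_univ]
    exact extChartAt_target_mem_nhdsWithin_of_mem (chartExpr_mapsTo S f x p hyT)
  have hset : ((extChartAt I x).symm ⁻¹' S ∩ range I : Set G) =ᶠ[𝓝 y] chartDomain I J S f x p := by
    have h1 := chartDomain_mem_nhdsWithin hf.continuousOn hyT
    rw [mem_nhdsWithin_iff_eventually] at h1
    filter_upwards [h1] with z hz
    exact propext ⟨hz, fun h => ⟨h.2.1, extChartAt_target_subset_range x h.1⟩⟩
  -- Density of the interior passes through the chart. It supplies the symmetry of second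
  -- derivatives that makes d commute with pullback in `extDerivWithin_pullback`.
  have hcl : y ∈ closure (interior (chartDomain I J S f x p)) := by
    rw [mem_closure_iff_nhds]
    intro t ht
    obtain ⟨t', ht't, ht'o, hyt'⟩ := mem_nhds_iff.1 (Filter.inter_mem ht hset.mem_iff)
    have hW : IsOpen ((extChartAt I x).source ∩ extChartAt I x ⁻¹' t') :=
      isOpen_extChartAt_preimage' x ht'o
    obtain ⟨w, ⟨hw1, hw2⟩, hw3⟩ := mem_closure_iff.1 (hSc hx) _ hW
      ⟨mem_extChartAt_source x, hyt'⟩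
    refine ⟨extChartAt I x w, (ht't hw2).1, ?_⟩
    have hO : IsOpen ((extChartAt I x).target ∩ (extChartAt I x).symm ⁻¹' (interior S)) :=
      (continuousOn_extChartAt_symm x).isOpen_inter_preimage (isOpen_extChartAt_target x)
        isOpen_interior
    refine mem_interior.2 ⟨_ ∩ t', fun z hz => ?_, hO.inter ht'o, ⟨⟨(extChartAt I x).map_source hw1,
      by rwa [mem_preimage, (extChartAt I x).left_inv hw1]⟩, hw2⟩⟩
    exact (ht't hz.2).2.1 ⟨interior_subset (s := S) hz.1.2, extChartAt_target_subset_range x hz.1.1⟩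
  have hpull := extDerivWithin_pullback hd1 (hg y hyT) (r := ∞)
    (by rw [minSmoothness_of_isRCLikeNormedField]; exact WithTop.coe_le_coe.2 le_top) hT hcl hyT
    (fun z hz => extChartAt_target_subset_range p (chartExpr_mapsTo S f x p hz))
  rw [hzero] at hpull
  rw [extD, extDerivWithin, fderivWithin_congr_set hset, ← extDerivWithin,
    extDerivWithin_congr' (fun z hz => coordForm_pullbackForm hS hf α x p hz) hyT, hpull]
  rfl

end Pullback

/-! ### Local nature of smoothness; the zero form -/

section Locality

variable {G : Type*} [NormedAddCommGroup G] [NormedSpace ℝ G]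
  {H : Type*} [TopologicalSpace H] {I : ModelWithCorners ℝ G H}
  {N : Type*} [TopologicalSpace N] [ChartedSpace H N]

/-- Smoothness of forms is a local property. -/
lemma smoothForm_of_locally {U : Set N} {k : ℕ} {α : DForm I N k}
    (h : ∀ x ∈ U, ∃ S ∈ 𝓝[U] x, ∃ β : DForm I N k, SmoothForm I S β ∧ ∀ z ∈ S, α z = β z) :
    SmoothForm I U α := by
  intro x₀ y hy
  obtain ⟨S, hS, β, hβ, hαβ⟩ := h _ hy.2
  have hyS : (extChartAt I x₀).symm y ∈ S := mem_of_mem_nhdsWithin hy.2 hS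
  have h1 : ContDiffOn ℝ ∞ (coordForm I α x₀)
      ((extChartAt I x₀).target ∩ (extChartAt I x₀).symm ⁻¹' S) :=
    (hβ x₀).congr fun z hz => by rw [coordForm, coordForm, hαβ _ hz.2]
  refine (h1 y ⟨hy.1, hyS⟩).mono_of_mem_nhdsWithin ?_
  have h2 : Filter.Tendsto (extChartAt I x₀).symm
      (𝓝[(extChartAt I x₀).target ∩ (extChartAt I x₀).symm ⁻¹' U] y)
      (𝓝[U] ((extChartAt I x₀).symm y)) :=
    (((continuousOn_extChartAt_symm x₀) y hy.1).mono inter_subset_left).tendsto_nhdsWithin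
      fun z hz => hz.2
  filter_upwards [h2 hS, self_mem_nhdsWithin] with z hz1 hz2
  exact ⟨hz2.1, hz1⟩

lemma smoothForm_zero (U : Set N) (k : ℕ) : SmoothForm I U (fun _ => 0 : DForm I N k) := by
  intro x₀
  exact contDiffOn_const (c := (0 : G [⋀^Fin k]→L[ℝ] ℝ))

lemma extD_zero (U : Set N) (k : ℕ) (x : N) : extD I U (fun _ => 0 : DForm I N k) x = 0 := by
  have h : coordForm I (fun _ => 0 : DForm I N k) x = fun _ => 0 := rfl
  rw [extD, h, extDerivWithin]
  have h' : fderivWithin ℝ (fun _ : G => (0 : G [⋀^Fin k]→L[ℝ] ℝ))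
      ((extChartAt I x).symm ⁻¹' U ∩ range I) (extChartAt I x x) = 0 :=
    fderivWithin_const_apply _
  have h'' : ContinuousAlternatingMap.alternatizeUncurryFin
      (0 : G →L[ℝ] G [⋀^Fin k]→L[ℝ] ℝ) = 0 := by
    ext v
    simp [ContinuousAlternatingMap.alternatizeUncurryFin_apply]
  rw [h', h'']
  rfl

end Locality

/-! ### Fibrewise scaling and smoothness of the radial field -/

section Scale

variable {n : ℕ} {M : Type*} [TopologicalSpace M] [ChartedSpace (EuclideanSpace ℝ (Fin n)) M]

lemma scale_scale (s t : ℝ) (u : TangentBundle (𝓡 n) M) :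
    scale s (scale t u) = scale (s * t) u :=
  congrArg (Bundle.TotalSpace.mk u.proj) (smul_smul s t u.snd)

lemma scale_one (u : TangentBundle (𝓡 n) M) : scale 1 u = u := by
  simp only [scale, one_smul]

variable [IsManifold (𝓡 n) ∞ M]

/-- Trivializations of the tangent bundle are linear on fibres, so in them the map is scalar
multiplication of the fibre coordinate. -/
lemma contMDiff_scale : ContMDiff (𝓘(ℝ, ℝ).prod (𝓡 n).tangent) (𝓡 n).tangent ∞
    (fun q : ℝ × TangentBundle (𝓡 n) M => scale q.1 q.2) := by
  have : IsManifold (𝓡 n) 1 M := IsManifold.of_le (n := ∞) (by simp)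
  intro q
  rw [Bundle.contMDiffAt_totalSpace]
  have h2 : ContMDiffAt (𝓘(ℝ, ℝ).prod (𝓡 n).tangent) (𝓡 n).tangent ∞
    (fun q : ℝ × TangentBundle (𝓡 n) M => q.2) q := contMDiffAt_snd
  have h3 := Bundle.contMDiffAt_totalSpace.1 h2
  refine ⟨h3.1, ?_⟩
  refine (contMDiffAt_fst.smul h3.2).congr_of_eventuallyEq ?_
  have hb : ∀ᶠ z in 𝓝 q, z.2.proj ∈ (trivializationAt (EuclideanSpace ℝ (Fin n))
      (TangentSpace (𝓡 n) : M → Type _) q.2.proj).baseSet :=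
    (h3.1.continuousAt).preimage_mem_nhds
      ((trivializationAt _ _ q.2.proj).open_baseSet.mem_nhds
        (FiberBundle.mem_baseSet_trivializationAt' _))
  filter_upwards [hb] with z hz
  have hl := (trivializationAt (EuclideanSpace ℝ (Fin n))
      (TangentSpace (𝓡 n) : M → Type _) q.2.proj).linear ℝ hz
  exact hl.map_smul z.1 z.2.snd

lemma contMDiff_scale_left (t : ℝ) : ContMDiff (𝓡 n).tangent (𝓡 n).tangent ∞
    (scale t : TangentBundle (𝓡 n) M → TangentBundle (𝓡 n) M) :=
  contMDiff_scale.comp (contMDiff_const.prodMk contMDiff_id)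

lemma contMDiff_scale_right (u : TangentBundle (𝓡 n) M) : ContMDiff 𝓘(ℝ, ℝ) (𝓡 n).tangent ∞
    (fun t : ℝ => scale t u) :=
  contMDiff_scale.comp (contMDiff_id.prodMk contMDiff_const)

lemma hasMFDerivAt_scale (u : TangentBundle (𝓡 n) M) :
    HasMFDerivAt 𝓘(ℝ, ℝ) (𝓡 n).tangent (fun t : ℝ => scale t u) 1
      (mfderiv 𝓘(ℝ, ℝ) (𝓡 n).tangent (fun t : ℝ => scale t u) 1) :=
  ((contMDiff_scale_right u).mdifferentiable (by simp) 1).hasMFDerivAt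

/-- The radial field is smooth. -/
lemma smoothField_radialField (S : Set (TangentBundle (𝓡 n) M)) :
    SmoothField (𝓡 n).tangent S (radialField : VField (𝓡 n).tangent (TangentBundle (𝓡 n) M)) := by
  -- The radial vector at u is the image of (∂_t, 0) at (1, u) under the tangent map of (t, u) ↦ tu,
  -- so the field is a composite of smooth maps.
  have hT := (contMDiff_scale (n := n) (M := M)).contMDiff_tangentMap (m := ∞) (by simp)
  have h1 : ContMDiff (𝓡 n).tangent 𝓘(ℝ, ℝ).tangent ∞
      (fun _ : TangentBundle (𝓡 n) M => (⟨1, (1 : ℝ)⟩ : TangentBundle 𝓘(ℝ, ℝ) ℝ)) :=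
    contMDiff_const
  have h0 : ContMDiff (𝓡 n).tangent (𝓡 n).tangent.tangent ∞
      (fun u : TangentBundle (𝓡 n) M =>
        (⟨u, 0⟩ : TangentBundle (𝓡 n).tangent (TangentBundle (𝓡 n) M))) :=
    Bundle.contMDiff_zeroSection ℝ _
  have h2 := (contMDiff_equivTangentBundleProd_symm (I := 𝓘(ℝ, ℝ)) (M := ℝ)
    (I' := (𝓡 n).tangent) (M' := TangentBundle (𝓡 n) M) (n := ∞)).comp (h1.prodMk h0)
  have h3 := hT.comp h2
  refine ContMDiff.contMDiffOn (h3.congr fun u => ?_)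
  have hval : mfderiv 𝓘(ℝ, ℝ) (𝓡 n).tangent (fun t : ℝ => scale t u) 1 (1 : ℝ) =
      mfderiv (𝓘(ℝ, ℝ).prod (𝓡 n).tangent) (𝓡 n).tangent
        (fun q : ℝ × TangentBundle (𝓡 n) M => scale q.1 q.2) (1, u) ((1 : ℝ), 0) := by
    have ha : HasMFDerivAt 𝓘(ℝ, ℝ) (𝓘(ℝ, ℝ).prod (𝓡 n).tangent)
        (fun t : ℝ => (t, u)) 1 _ :=
      (hasMFDerivAt_id (I := 𝓘(ℝ, ℝ)) (1 : ℝ)).prodMk (hasMFDerivAt_const u (1 : ℝ))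
    have hb := ((contMDiff_scale (n := n) (M := M)).mdifferentiable (by simp) (1, u)).hasMFDerivAt
    have hc := HasMFDerivAt.comp (1 : ℝ) hb ha
    rw [HasMFDerivAt.mfderiv (f := fun t : ℝ => scale t u) hc]
    rfl
  -- `scale 1 u` equals `u` only propositionally, so base point and vector are compared separately.
  have hpt : ∀ (p q : TangentBundle (𝓡 n) M) (_ : p = q)
      (x y : EuclideanSpace ℝ (Fin n) × EuclideanSpace ℝ (Fin n)) (_ : x = y),
      (⟨p, x⟩ : TangentBundle (𝓡 n).tangent (TangentBundle (𝓡 n) M)) = ⟨q, y⟩ := by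
    rintro p _ rfl x _ rfl
    rfl
  exact hpt _ _ (scale_one u).symm _ _ hval

end Scale

/-! ### Equal nonzero simple bivectors span the same plane -/

section LinearAlgebra

variable {V : Type*} [AddCommGroup V] [Module ℝ V]

/-- The alternating form `f ∧ g`. -/
def wedgeDual (f g : V →ₗ[ℝ] ℝ) : V [⋀^Fin 2]→ₗ[ℝ] ℝ :=
  Matrix.detRowAlternating.compLinearMap (LinearMap.pi ![f, g])

lemma wedgeDual_apply (f g : V →ₗ[ℝ] ℝ) (a b : V) :
    wedgeDual f g ![a, b] = f a * g b - g a * f b := by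
  change Matrix.det (Matrix.of fun i => LinearMap.pi ![f, g] (![a, b] i)) = _
  rw [Matrix.det_fin_two]
  simp

/-- If x were outside the span, a functional f with f x ≠ 0 would kill a and b. Pairing f ∧ g with
both bivectors, for every g, forces y to be a multiple of x. Then x ∧ y, and so a ∧ b, pairs to zero
with all f' ∧ g', against independence. -/
lemma left_mem_span_of_ιMulti_eq {a b x y : V} (hab : LinearIndependent ℝ ![a, b])
    (h : exteriorPower.ιMulti ℝ 2 ![a, b] = exteriorPower.ιMulti ℝ 2 ![x, y]) :
    x ∈ Submodule.span ℝ {a, b} := by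
  have key : ∀ f g : V →ₗ[ℝ] ℝ, f a * g b - g a * f b = f x * g y - g x * f y := by
    intro f g
    have := congrArg (exteriorPower.alternatingMapLinearEquiv (wedgeDual f g)) h
    simpa only [exteriorPower.alternatingMapLinearEquiv_apply_ιMulti, wedgeDual_apply] using this
  by_contra hx
  obtain ⟨f, hfx, hf⟩ := Submodule.exists_le_ker_of_notMem hx
  have hfa : f a = 0 := hf (Submodule.subset_span (by simp))
  have hfb : f b = 0 := hf (Submodule.subset_span (by simp))
  have hy : ∀ g : V →ₗ[ℝ] ℝ, f x * g y = g x * f y := by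
    intro g
    have := key f g
    rw [hfa, hfb] at this
    linarith
  have hz : ∀ f' g' : V →ₗ[ℝ] ℝ, f' a * g' b - g' a * f' b = 0 := by
    intro f' g'
    have h1 := hy f'
    have h2 := hy g'
    refine (mul_eq_zero.1 ?_).resolve_left hfx
    rw [key f' g']
    linear_combination f' x * h2 - g' x * h1
  rw [LinearIndependent.pair_iff] at hab
  have ha : a ∉ Submodule.span ℝ {b} := by
    intro ha
    obtain ⟨c, rfl⟩ := Submodule.mem_span_singleton.1 ha
    have := (hab 1 (-c) (by simp)).1
    norm_num at this
  have hb : b ∉ Submodule.span ℝ {a} := by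
    intro hb
    obtain ⟨c, rfl⟩ := Submodule.mem_span_singleton.1 hb
    have := (hab (-c) 1 (by simp)).2
    norm_num at this
  obtain ⟨f', hf'a, hf'⟩ := Submodule.exists_le_ker_of_notMem ha
  obtain ⟨g', hg'b, hg'⟩ := Submodule.exists_le_ker_of_notMem hb
  have hf'b : f' b = 0 := hf' (Submodule.mem_span_singleton_self b)
  have := hz f' g'
  rw [hf'b, mul_zero, sub_zero] at this
  exact (mul_ne_zero hf'a hg'b) this

lemma mem_span_of_ιMulti_eq {a b x y : V} (hab : LinearIndependent ℝ ![a, b])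
    (h : exteriorPower.ιMulti ℝ 2 ![a, b] = exteriorPower.ιMulti ℝ 2 ![x, y]) :
    x ∈ Submodule.span ℝ {a, b} ∧ y ∈ Submodule.span ℝ {a, b} := by
  have swap : ∀ c d : V, exteriorPower.ιMulti ℝ 2 ![c, d] = -exteriorPower.ιMulti ℝ 2 ![d, c] := by
    intro c d
    have := (exteriorPower.ιMulti ℝ 2 (M := V)).map_swap ![d, c] (i := 0) (j := 1) (by simp)
    rw [← this]
    congr 1
    funext i
    fin_cases i <;> simp
  refine ⟨left_mem_span_of_ιMulti_eq hab h, ?_⟩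
  have h' : exteriorPower.ιMulti ℝ 2 ![b, a] = exteriorPower.ιMulti ℝ 2 ![y, x] := by
    rw [swap b a, swap y x, h]
  have := left_mem_span_of_ιMulti_eq (LinearIndependent.pair_symm_iff.1 hab) h'
  rwa [Set.pair_comm]

end LinearAlgebra

/-! ### Interior products -/

section InteriorProd

variable {V V' : Type*} [AddCommGroup V] [Module ℝ V] [TopologicalSpace V]
  [AddCommGroup V'] [Module ℝ V'] [TopologicalSpace V']

lemma interiorProd_zero_right (X : V) {k : ℕ} :
    interiorProd X (0 : V [⋀^Fin k]→L[ℝ] ℝ) = 0 := by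
  cases k with
  | zero => rfl
  | succ k => ext v; rfl

lemma interiorProd_add_left (X Y : V) {k : ℕ} (α : V [⋀^Fin k]→L[ℝ] ℝ) :
    interiorProd (X + Y) α = interiorProd X α + interiorProd Y α := by
  cases k with
  | zero => simp [interiorProd]
  | succ k => simp [interiorProd]

lemma interiorProd_smul_left (c : ℝ) (X : V) {k : ℕ} (α : V [⋀^Fin k]→L[ℝ] ℝ) :
    interiorProd (c • X) α = c • interiorProd X α := by
  cases k with
  | zero => simp [interiorProd]
  | succ k => simp [interiorProd]

lemma interiorProd_zero_left {k : ℕ} (α : V [⋀^Fin k]→L[ℝ] ℝ) :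
    interiorProd (0 : V) α = 0 := by
  simpa using interiorProd_smul_left (0 : ℝ) (0 : V) α

/-- This is i_X(L^*α) = L^*(i_{LX} α). In degree zero, which is the case 2n - 2 = 0, the contraction
vanishes by convention. -/
lemma interiorProd_compContinuousLinearMap {k : ℕ} (α : V' [⋀^Fin k]→L[ℝ] ℝ) (L : V →L[ℝ] V')
    (X : V) (h : interiorProd (L X) α = 0) :
    interiorProd X (α.compContinuousLinearMap L) = 0 := by
  cases k with
  | zero => rfl
  | succ k =>
    ext v
    have := DFunLike.congr_fun h (fun i => L (v i))
    simp only [interiorProd] at this ⊢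
    refine Eq.trans ?_ this
    change α _ = α _
    congr 1
    funext i
    refine Fin.cases ?_ (fun j => ?_) i <;> rfl

lemma interiorProd_eq_zero_of_mem_span {k : ℕ} {α : V [⋀^Fin k]→L[ℝ] ℝ} {a b x : V}
    (ha : interiorProd a α = 0) (hb : interiorProd b α = 0)
    (hx : x ∈ Submodule.span ℝ {a, b}) : interiorProd x α = 0 := by
  obtain ⟨c, d, rfl⟩ := Submodule.mem_span_pair.1 hx
  rw [interiorProd_add_left, interiorProd_smul_left, interiorProd_smul_left, ha, hb]
  simp

end InteriorProd

/-! ### Lifting smoothness through an immersion -/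

section Immersion

variable {E₁ E₂ E₃ : Type*} [NormedAddCommGroup E₁] [NormedSpace ℝ E₁]
  [NormedAddCommGroup E₂] [NormedSpace ℝ E₂] [NormedAddCommGroup E₃] [NormedSpace ℝ E₃]
  {H₁ H₂ H₃ : Type*} [TopologicalSpace H₁] [TopologicalSpace H₂] [TopologicalSpace H₃]
  {I : ModelWithCorners ℝ E₁ H₁} {J : ModelWithCorners ℝ E₂ H₂} {K : ModelWithCorners ℝ E₃ H₃}
  {N : Type*} [TopologicalSpace N] [ChartedSpace H₁ N]
  {P : Type*} [TopologicalSpace P] [ChartedSpace H₂ P]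
  {Q : Type*} [TopologicalSpace Q] [ChartedSpace H₃ Q]

/-- A map that is continuous at `x` within `S` is smooth there if its composition with an immersion
is smooth. -/
lemma contMDiffWithinAt_of_comp_isImmersionAt {f : N → P} {φ : P → Q} {S : Set N} {x : N}
    (hφ : IsImmersionAt J K ∞ φ (f x)) (hx : x ∈ S) (hf : ContinuousWithinAt f S x)
    (hc : ContMDiffWithinAt I K ∞ (φ ∘ f) S x) : ContMDiffWithinAt I J ∞ f S x := by
  obtain ⟨F, _, _, h⟩ := hφ
  obtain ⟨t, ht, htx⟩ := mem_nhdsWithin_iff_exists_mem_nhds_inter.1 (hf.preimage_mem_nhdsWithin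
    (h.domChart.open_source.mem_nhds h.mem_domChart_source))
  -- Continuity of `f` allows shrinking `S` so that `f` stays in the chart where the immersion has
  -- its normal form.
  suffices hs : ContMDiffWithinAt I J ∞ f (t ∩ S) x from
    hs.mono_of_mem_nhdsWithin (Filter.inter_mem (mem_nhdsWithin_of_mem_nhds ht) self_mem_nhdsWithin)
  have hxt : x ∈ t ∩ S := ⟨mem_of_mem_nhds ht, hx⟩
  rw [contMDiffWithinAt_iff_of_mem_maximalAtlas' h.domChart_mem_maximalAtlas h.mem_domChart_source]
  refine ⟨hf.mono inter_subset_right, ?_⟩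
  have hc' := hc.mono (inter_subset_right : t ∩ S ⊆ S)
  rw [contMDiffWithinAt_iff_of_mem_maximalAtlas' (f := φ ∘ f) h.codChart_mem_maximalAtlas
    h.mem_codChart_source] at hc'
  -- In these charts the immersion is z ↦ (z, 0) up to a linear equivalence, so undoing the
  -- equivalence and projecting recovers `f`.
  have hL : ContDiff ℝ ∞ (Prod.fst ∘ h.equiv.symm : E₃ → E₂) :=
    contDiff_fst.comp h.equiv.symm.contDiff
  have hmem : extChartAt I x x ∈ (extChartAt I x).symm ⁻¹' (t ∩ S) ∩ range I :=
    ⟨by rwa [mem_preimage, extChartAt_to_inv],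
      extChartAt_target_subset_range x (mem_extChartAt_target x)⟩
  refine (hL.comp_contDiffWithinAt hc'.2).congr_of_mem (fun y hy => ?_) hmem
  have hy' : f ((extChartAt I x).symm y) ∈ h.domChart.source := htx hy.1
  have hw := h.writtenInCharts ((h.domChart.extend J).map_source
    (by rwa [OpenPartialHomeomorph.extend_source]))
  simp only [Function.comp_apply] at hw ⊢
  rw [(h.domChart.extend J).left_inv (by rwa [OpenPartialHomeomorph.extend_source])] at hw
  rw [hw]
  simp

end Immersion

/-! ### Implicit function theorem on a manifold -/

section Implicit

variable {B : Type*} [NormedAddCommGroup B] [NormedSpace ℝ B] [CompleteSpace B]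
  {H : Type*} [TopologicalSpace H] {I : ModelWithCorners ℝ B H} [I.Boundaryless]
  {N : Type*} [TopologicalSpace N] [ChartedSpace H N]

/-- The implicit function theorem for a scalar equation depending on a point of a manifold. -/
lemma exists_implicit_scalar {f : N × ℝ → ℝ} {x : N} {s : ℝ}
    (hf : ContMDiffAt (I.prod 𝓘(ℝ, ℝ)) 𝓘(ℝ, ℝ) ∞ f (x, s))
    (hd : deriv (fun t => f (x, t)) s ≠ 0) :
    ∃ σ : N → ℝ, ContMDiffAt I 𝓘(ℝ, ℝ) ∞ σ x ∧ σ x = s ∧ ∀ᶠ z in 𝓝 x, f (z, σ z) = f (x, s) := by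
  set φ := extChartAt I x
  let g : B × ℝ → ℝ := fun q => f (φ.symm q.1, q.2)
  have hg : ContDiffAt ℝ ∞ g (φ x, s) := by
    rw [← contMDiffAt_iff_contDiffAt]
    have h1 : ContMDiffAt 𝓘(ℝ, B × ℝ) I ∞ (fun q : B × ℝ => φ.symm q.1) (φ x, s) := by
      have : ContMDiffAt 𝓘(ℝ, B) I ∞ φ.symm (φ x) := by
        have := contMDiffWithinAt_extChartAt_symm_range_self (I := I) (n := ∞) x
        rwa [I.range_eq_univ, contMDiffWithinAt_univ] at this
      exact ContMDiffAt.comp (φ x, s) this contDiffAt_fst.contMDiffAt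
    have h2 : ContMDiffAt 𝓘(ℝ, B × ℝ) 𝓘(ℝ, ℝ) ∞ (fun q : B × ℝ => q.2) (φ x, s) :=
      contDiffAt_snd.contMDiffAt
    refine ContMDiffAt.comp_of_eq (g := f) (f := fun q : B × ℝ => (φ.symm q.1, q.2)) hf
      (h1.prodMk h2) ?_
    simp [φ]
  -- The partial derivative in the real variable is multiplication by a nonzero number, hence
  -- invertible.
  have hinr : ∀ c : ℝ, (fderiv ℝ g (φ x, s) ∘L .inr ℝ B ℝ) c =
      c * deriv (fun t => f (x, t)) s := by
    intro c
    have h1 : HasFDerivAt (fun t : ℝ => g (φ x, t)) (fderiv ℝ g (φ x, s) ∘L .inr ℝ B ℝ) s :=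
      HasFDerivAt.comp s (hg.differentiableAt (by simp)).hasFDerivAt (hasFDerivAt_prodMk_right _ _)
    have h2 : (fun t : ℝ => g (φ x, t)) = fun t => f (x, t) := by
      funext t; simp [g, φ]
    rw [h2] at h1
    rw [h1.hasDerivAt.deriv, ← smul_eq_mul, ← map_smul]
    simp
  have hinv : (fderiv ℝ g (φ x, s) ∘L .inr ℝ B ℝ).IsInvertible := by
    refine ⟨ContinuousLinearEquiv.unitsEquivAut ℝ (Units.mk0 _ hd), ?_⟩
    ext
    simp [hinr]
  let σ := hg.implicitFunction (by simp) hinv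
  have hσ : ContDiffAt ℝ ∞ σ (φ x) := hg.contDiffAt_implicitFunction (by simp) hinv
  refine ⟨σ ∘ φ, ?_, hg.implicitFunction_apply_self (by simp) hinv, ?_⟩
  · exact ContMDiffAt.comp x hσ.contMDiffAt contMDiffAt_extChartAt
  · have h1 := hg.eventually_apply_implicitFunction (by simp) hinv
    have h2 := (continuousAt_extChartAt (I := I) x).eventually h1
    filter_upwards [h2, extChartAt_source_mem_nhds (I := I) x] with z hz hzs
    have hz' : f (φ.symm (φ z), σ (φ z)) = f (φ.symm (φ x), s) := hz
    rw [φ.left_inv hzs, φ.left_inv (mem_extChartAt_source x)] at hz'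
    exact hz'

end Implicit

/-! ### Scalar lifts detect vertical vectors -/

section Detection

variable {n : ℕ} {M : Type*} [TopologicalSpace M] [T2Space M]
  [ChartedSpace (EuclideanSpace ℝ (Fin n)) M] [IsManifold (𝓡 n) ∞ M]

/-- Germs of linear functions of the chart extend to smooth functions. -/
lemma exists_contMDiff_eventuallyEq_chart (p : M) (ℓ : EuclideanSpace ℝ (Fin n) →L[ℝ] ℝ) :
    ∃ h : M → ℝ, ContMDiff (𝓡 n) 𝓘(ℝ, ℝ) ∞ h ∧
      h =ᶠ[𝓝 p] fun x => ℓ (extChartAt (𝓡 n) p x) := by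
  let f : SmoothBumpFunction (𝓡 n) p := Classical.arbitrary _
  have hg : ContMDiffOn (𝓡 n) 𝓘(ℝ, ℝ) ∞ (fun x => ℓ (extChartAt (𝓡 n) p x))
      (chartAt (EuclideanSpace ℝ (Fin n)) p).source :=
    ℓ.contMDiff.comp_contMDiffOn contMDiffOn_extChartAt
  refine ⟨fun x => f x • ℓ (extChartAt (𝓡 n) p x), f.contMDiff_smul hg, ?_⟩
  filter_upwards [f.eventuallyEq_one] with x hx
  rw [hx]
  simp

-- For h a linear function of the chart, dh is ℓ applied to the derivative of the chart, which on a
-- tangent vector is its fibre coordinate.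
omit [T2Space M] in
lemma scalarLift_eventuallyEq {h : M → ℝ} {u : TangentBundle (𝓡 n) M}
    {ℓ : EuclideanSpace ℝ (Fin n) →L[ℝ] ℝ}
    (hh : h =ᶠ[𝓝 u.proj] fun x => ℓ (extChartAt (𝓡 n) u.proj x)) :
    scalarLift h =ᶠ[𝓝 u] fun w => ℓ ((trivializationAt (EuclideanSpace ℝ (Fin n))
      (TangentSpace (𝓡 n) : M → Type _) u.proj w).2) := by
  have : IsManifold (𝓡 n) 1 M := IsManifold.of_le (n := ∞) (by simp)
  have hproj : ContinuousAt (Bundle.TotalSpace.proj : TangentBundle (𝓡 n) M → M) u :=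
    (FiberBundle.continuous_proj (EuclideanSpace ℝ (Fin n))
      (TangentSpace (𝓡 n) : M → Type _)).continuousAt
  have h1 := hproj.eventually hh.eventuallyEq_nhds
  have h2 := hproj.eventually
    (chart_source_mem_nhds (EuclideanSpace ℝ (Fin n)) u.proj)
  filter_upwards [h1, h2] with w hw1 hw2
  have hw2' : w.proj ∈ (chartAt (EuclideanSpace ℝ (Fin n)) u.proj).source := hw2
  have hφ := (mdifferentiableAt_extChartAt (I := 𝓡 n) hw2').hasMFDerivAt
  have hc := (ℓ.hasMFDerivAt (x := extChartAt (𝓡 n) u.proj w.proj)).comp w.proj hφ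
  have hm : mfderiv (𝓡 n) 𝓘(ℝ, ℝ) h w.proj = _ := hw1.mfderiv_eq.trans hc.mfderiv
  have ht := TangentBundle.continuousLinearMapAt_trivializationAt (I := 𝓡 n) hw2'
  have hb : w.proj ∈ (trivializationAt (EuclideanSpace ℝ (Fin n))
      (TangentSpace (𝓡 n) : M → Type _) u.proj).baseSet := by simpa using hw2'
  have ht' : mfderiv (𝓡 n) (𝓡 n) (extChartAt (𝓡 n) u.proj) w.proj w.snd =
      (trivializationAt (EuclideanSpace ℝ (Fin n))
        (TangentSpace (𝓡 n) : M → Type _) u.proj w).2 := by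
    refine (DFunLike.congr_fun ht w.snd).symm.trans ?_
    exact congrFun (Bundle.Trivialization.coe_linearMapAt_of_mem (R := ℝ) _ hb) w.snd
  rw [scalarLift, hm]
  exact congrArg ℓ ht'

omit [T2Space M] in
lemma contMDiff_scalarLift {h : M → ℝ} (hh : ContMDiff (𝓡 n) 𝓘(ℝ, ℝ) ∞ h) :
    ContMDiff (𝓡 n).tangent 𝓘(ℝ, ℝ) ∞ (scalarLift h : TangentBundle (𝓡 n) M → ℝ) := by
  have hT := hh.contMDiff_tangentMap (m := ∞) (by simp)
  intro u
  have := (Bundle.contMDiffAt_totalSpace.1 (hT u)).2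
  refine this.congr_of_eventuallyEq (Filter.Eventually.of_forall fun w => ?_)
  simp [scalarLift, tangentMap]
  rfl

lemma exists_mfderiv_ne_zero {u : TangentBundle (𝓡 n) M} (hu : u.snd ≠ 0) :
    ∃ h : M → ℝ, ContMDiff (𝓡 n) 𝓘(ℝ, ℝ) ∞ h ∧ scalarLift h u ≠ 0 := by
  have : IsManifold (𝓡 n) 1 M := IsManifold.of_le (n := ∞) (by simp)
  have hne : (trivializationAt (EuclideanSpace ℝ (Fin n))
      (TangentSpace (𝓡 n) : M → Type _) u.proj u).2 ≠ 0 := by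
    intro h0
    apply hu
    have hb := FiberBundle.mem_baseSet_trivializationAt' (F := EuclideanSpace ℝ (Fin n))
      (E := (TangentSpace (𝓡 n) : M → Type _)) u.proj
    have := ((trivializationAt (EuclideanSpace ℝ (Fin n))
      (TangentSpace (𝓡 n) : M → Type _) u.proj).continuousLinearEquivAt ℝ u.proj hb).map_eq_zero_iff
        (x := u.snd)
    exact this.1 h0
  obtain ⟨ℓ, hℓ⟩ := SeparatingDual.exists_ne_zero (R := ℝ) hne
  obtain ⟨h, hh, he⟩ := exists_contMDiff_eventuallyEq_chart u.proj ℓ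
  refine ⟨h, hh, ?_⟩
  rw [(scalarLift_eventuallyEq he).eq_of_nhds]
  exact hℓ

/-- A vertical vector that annihilates all scalar lifts vanishes. -/
lemma eq_zero_of_dirDeriv_scalarLift {u : TangentBundle (𝓡 n) M}
    {Z : TangentSpace (𝓡 n).tangent u}
    (hv : mfderiv (𝓡 n).tangent (𝓡 n)
      (Bundle.TotalSpace.proj : TangentBundle (𝓡 n) M → M) u Z = 0)
    (hd : ∀ h : M → ℝ, ContMDiff (𝓡 n) 𝓘(ℝ, ℝ) ∞ h → dirDeriv (scalarLift h) u Z = 0) :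
    Z = 0 := by
  have : IsManifold (𝓡 n) 1 M := IsManifold.of_le (n := ∞) (by simp)
  let τ : TangentBundle (𝓡 n) M → EuclideanSpace ℝ (Fin n) := fun w =>
    (trivializationAt (EuclideanSpace ℝ (Fin n)) (TangentSpace (𝓡 n) : M → Type _) u.proj w).2
  have hid := Bundle.contMDiffAt_totalSpace.1
    (contMDiffAt_id (I := (𝓡 n).tangent) (n := ∞) (x := u))
  have hτ : MDifferentiableAt (𝓡 n).tangent 𝓘(ℝ, EuclideanSpace ℝ (Fin n)) τ u := hid.2.mdifferentiableAt (by simp)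
  have hπ : MDifferentiableAt (𝓡 n).tangent (𝓡 n)
      (Bundle.TotalSpace.proj : TangentBundle (𝓡 n) M → M) u := hid.1.mdifferentiableAt (by simp)
  have hτZ : mfderiv (𝓡 n).tangent 𝓘(ℝ, EuclideanSpace ℝ (Fin n)) τ u Z = 0 := by
    by_contra hne
    have hsep : ∀ x : EuclideanSpace ℝ (Fin n), x ≠ 0 →
        ∃ ℓ : EuclideanSpace ℝ (Fin n) →L[ℝ] ℝ, ℓ x ≠ 0 :=
      fun x hx => SeparatingDual.exists_ne_zero hx
    obtain ⟨ℓ, hℓ⟩ := hsep _ hne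
    obtain ⟨h, hh, he⟩ := exists_contMDiff_eventuallyEq_chart u.proj ℓ
    apply hℓ
    have h1 := hd h hh
    have hc := (ℓ.hasMFDerivAt (x := τ u)).comp u hτ.hasMFDerivAt
    rw [dirDeriv, (scalarLift_eventuallyEq he).mfderiv_eq] at h1
    have h2 : mfderiv (𝓡 n).tangent 𝓘(ℝ, ℝ) (fun w => ℓ (τ w)) u = _ := hc.mfderiv
    exact (DFunLike.congr_fun h2 Z).symm.trans h1
  have hφ := (mdifferentiableAt_extChartAt (I := 𝓡 n)
    (mem_chart_source (EuclideanSpace ℝ (Fin n)) u.proj)).hasMFDerivAt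
  have hφπ := hφ.comp u hπ.hasMFDerivAt
  -- The chart of TM at u is the chart of M after π, paired with the fibre coordinate τ. Both
  -- components of `Z` in this chart vanish, the first by verticality and the second by `hτZ`.
  have heq : (extChartAt (𝓡 n).tangent u : TangentBundle (𝓡 n) M → EuclideanSpace ℝ (Fin n) × EuclideanSpace ℝ (Fin n)) =ᶠ[𝓝 u]
      fun w => ((extChartAt (𝓡 n) u.proj ∘ Bundle.TotalSpace.proj) w, τ w) := by
    have hb : ∀ᶠ z in 𝓝 u, z.proj ∈ (trivializationAt (EuclideanSpace ℝ (Fin n))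
        (TangentSpace (𝓡 n) : M → Type _) u.proj).baseSet :=
      (hid.1.continuousAt).preimage_mem_nhds
        ((trivializationAt _ _ u.proj).open_baseSet.mem_nhds
          (FiberBundle.mem_baseSet_trivializationAt' _))
    filter_upwards [hb] with w hw
    have := FiberBundle.extChartAt (IB := 𝓡 n) (F := EuclideanSpace ℝ (Fin n))
      (E := (TangentSpace (𝓡 n) : M → Type _)) u
    rw [show (𝓡 n).tangent = (𝓡 n).prod 𝓘(ℝ, EuclideanSpace ℝ (Fin n)) from rfl, this]
    simp only [PartialEquiv.coe_trans, Function.comp_apply, PartialEquiv.prod_coe,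
      PartialEquiv.refl_coe, id]
    refine Prod.ext ?_ rfl
    change extChartAt (𝓡 n) u.proj (trivializationAt (EuclideanSpace ℝ (Fin n))
        (TangentSpace (𝓡 n) : M → Type _) u.proj w).1 = _
    rw [Bundle.Trivialization.coe_fst' _ hw]
  obtain ⟨e, he⟩ := isInvertible_mfderiv_extChartAt (I := (𝓡 n).tangent)
    (mem_extChartAt_source (I := (𝓡 n).tangent) u)
  have hΦ := (mdifferentiableAt_extChartAt (I := (𝓡 n).tangent)
    (mem_chart_source _ u)).hasMFDerivAt
  let π₁ := ContinuousLinearMap.fst ℝ (EuclideanSpace ℝ (Fin n)) (EuclideanSpace ℝ (Fin n))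
  let π₂ := ContinuousLinearMap.snd ℝ (EuclideanSpace ℝ (Fin n)) (EuclideanSpace ℝ (Fin n))
  have h1 := (π₁.hasMFDerivAt (x := extChartAt (𝓡 n).tangent u u)).comp u hΦ
  have h2 := (π₂.hasMFDerivAt (x := extChartAt (𝓡 n).tangent u u)).comp u hΦ
  have h1' := hasMFDerivAt_unique h1 (hφπ.congr_of_eventuallyEq
    (heq.mono fun w hw => congrArg Prod.fst hw))
  have h2' := hasMFDerivAt_unique h2 (hτ.hasMFDerivAt.congr_of_eventuallyEq
    (heq.mono fun w hw => congrArg Prod.snd hw))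
  have hZ : mfderiv (𝓡 n).tangent 𝓘(ℝ, EuclideanSpace ℝ (Fin n) × EuclideanSpace ℝ (Fin n))
      (extChartAt (𝓡 n).tangent u) u Z = 0 := by
    refine Prod.ext ?_ ((DFunLike.congr_fun h2' Z).trans hτZ)
    refine (DFunLike.congr_fun h1' Z).trans ?_
    change mfderiv (𝓡 n) 𝓘(ℝ, EuclideanSpace ℝ (Fin n)) (extChartAt (𝓡 n) u.proj) u.proj
      (mfderiv (𝓡 n).tangent (𝓡 n) Bundle.TotalSpace.proj u Z) = 0
    rw [hv, map_zero]
  rw [← he] at hZ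
  exact e.map_eq_zero_iff.1 hZ

end Detection

/-! ### Derivatives along rays and homogeneity of Vlasov fields -/

section Radial

variable {n : ℕ} {M : Type*} [TopologicalSpace M]
  [ChartedSpace (EuclideanSpace ℝ (Fin n)) M] [IsManifold (𝓡 n) ∞ M]
  {G : Type*} [NormedAddCommGroup G] [NormedSpace ℝ G]
  {H : Type*} [TopologicalSpace H] {K : ModelWithCorners ℝ G H}
  {P : Type*} [TopologicalSpace P] [ChartedSpace H P]

/-- The derivative at `t = 1` of `F (t u)` is the derivative of `F` along the radial field. -/
lemma hasMFDerivWithinAt_comp_scale {F : TangentBundle (𝓡 n) M → P}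
    {S : Set (TangentBundle (𝓡 n) M)} {u : TangentBundle (𝓡 n) M} {T : Set ℝ}
    {F' : EuclideanSpace ℝ (Fin n) × EuclideanSpace ℝ (Fin n) →L[ℝ] G}
    (hF : HasMFDerivWithinAt (𝓡 n).tangent K F S u F') (hT : ∀ t ∈ T, scale t u ∈ S) :
    HasMFDerivWithinAt 𝓘(ℝ, ℝ) K (fun t : ℝ => F (scale t u)) T 1
      (F' ∘L (mfderiv 𝓘(ℝ, ℝ) (𝓡 n).tangent (fun t : ℝ => scale t u) 1 :
        ℝ →L[ℝ] EuclideanSpace ℝ (Fin n) × EuclideanSpace ℝ (Fin n))) := by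
  have hF1 : HasMFDerivWithinAt (𝓡 n).tangent K F S (scale 1 u) F' := by
    have : ∀ q, q = u → HasMFDerivWithinAt (𝓡 n).tangent K F S q F' := by
      rintro q rfl
      exact hF
    exact this _ (scale_one u)
  exact hF1.comp (1 : ℝ) (hasMFDerivAt_scale u).hasMFDerivWithinAt hT

lemma hasDerivAt_comp_scale {F : TangentBundle (𝓡 n) M → ℝ} {u : TangentBundle (𝓡 n) M}
    (hF : MDifferentiableAt (𝓡 n).tangent 𝓘(ℝ, ℝ) F u) :
    HasDerivAt (fun t : ℝ => F (scale t u)) (dirDeriv F u (radialField u)) 1 := by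
  let A : EuclideanSpace ℝ (Fin n) × EuclideanSpace ℝ (Fin n) →L[ℝ] ℝ :=
    mfderiv (𝓡 n).tangent 𝓘(ℝ, ℝ) F u
  have h := hasMFDerivWithinAt_comp_scale (T := univ) (F' := A)
    (hF.hasMFDerivAt.hasMFDerivWithinAt (s := univ)) (fun _ _ => mem_univ _)
  rw [hasMFDerivWithinAt_univ] at h
  have h' : HasFDerivAt (fun t : ℝ => F (scale t u))
      (A ∘L (mfderiv 𝓘(ℝ, ℝ) (𝓡 n).tangent (fun t : ℝ => scale t u) 1 :
        ℝ →L[ℝ] EuclideanSpace ℝ (Fin n) × EuclideanSpace ℝ (Fin n))) 1 :=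
    hasMFDerivAt_iff_hasFDerivAt.1 h
  exact h'.hasDerivAt

lemma dirDeriv_sub_smul (F : TangentBundle (𝓡 n) M → ℝ) (u : TangentBundle (𝓡 n) M)
    (X Y : TangentSpace (𝓡 n).tangent u) (c : ℝ) :
    dirDeriv F u (X - c • Y) = dirDeriv F u X - c * dirDeriv F u Y := by
  rw [dirDeriv, map_sub, map_smul]
  rfl

/-- The radial field is vertical. -/
lemma mfderiv_proj_radialField (u : TangentBundle (𝓡 n) M) :
    mfderiv (𝓡 n).tangent (𝓡 n) (Bundle.TotalSpace.proj : TangentBundle (𝓡 n) M → M) u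
      (radialField u) = 0 := by
  have hπ : MDifferentiableAt (𝓡 n).tangent (𝓡 n)
      (Bundle.TotalSpace.proj : TangentBundle (𝓡 n) M → M) u :=
    (Bundle.contMDiff_proj (TangentSpace (𝓡 n) : M → Type _) (n := 1)).mdifferentiable
      (by simp) u
  have h := hasMFDerivWithinAt_comp_scale (T := univ)
    (hπ.hasMFDerivAt.hasMFDerivWithinAt (s := univ)) (fun _ _ => mem_univ _)
  rw [hasMFDerivWithinAt_univ] at h
  exact DFunLike.congr_fun (hasMFDerivAt_unique h (hasMFDerivAt_const u.proj (1 : ℝ))) 1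

omit [IsManifold (𝓡 n) ∞ M] in
lemma scalarLift_scale (h : M → ℝ) (t : ℝ) (u : TangentBundle (𝓡 n) M) :
    scalarLift h (scale t u) = t * scalarLift h u :=
  (mfderiv (𝓡 n) 𝓘(ℝ, ℝ) h u.proj).map_smul t u.snd

/-- Euler's identity: scalar lifts are homogeneous of degree one on fibres. -/
lemma dirDeriv_scalarLift_radialField {h : M → ℝ} (hh : ContMDiff (𝓡 n) 𝓘(ℝ, ℝ) ∞ h)
    (u : TangentBundle (𝓡 n) M) :
    dirDeriv (scalarLift h) u (radialField u) = scalarLift h u := by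
  have h1 := hasDerivAt_comp_scale ((contMDiff_scalarLift hh).mdifferentiable (by simp) u)
  have h2 : HasDerivAt (fun t : ℝ => scalarLift h (scale t u)) (scalarLift h u) 1 := by
    simp only [scalarLift_scale]
    simpa using (hasDerivAt_id (1 : ℝ)).mul_const (scalarLift h u)
  exact h1.unique h2

/-- The radial field and a horizontal vector are linearly independent off the zero section. -/
lemma linearIndependent_radialField [T2Space M] {u : TangentBundle (𝓡 n) M} (hu : u.snd ≠ 0)
    {Z : TangentSpace (𝓡 n).tangent u}
    (hZ : mfderiv (𝓡 n).tangent (𝓡 n) (Bundle.TotalSpace.proj : TangentBundle (𝓡 n) M → M) u Z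
      = u.snd) :
    LinearIndependent ℝ ![radialField u, Z] := by
  rw [LinearIndependent.pair_iff]
  intro a b hab
  -- Projecting to M kills the radial term and leaves b u = 0. A scalar lift nonzero at u then
  -- isolates a.
  have hb : b = 0 := by
    have := congrArg (mfderiv (𝓡 n).tangent (𝓡 n)
      (Bundle.TotalSpace.proj : TangentBundle (𝓡 n) M → M) u) hab
    rw [map_add, map_smul, map_smul, mfderiv_proj_radialField, hZ, map_zero, smul_zero,
      zero_add] at this
    exact (smul_eq_zero.1 this).resolve_right hu
  refine ⟨?_, hb⟩
  obtain ⟨h, hh, hne⟩ := exists_mfderiv_ne_zero hu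
  have h1 := congrArg (mfderiv (𝓡 n).tangent 𝓘(ℝ, ℝ) (scalarLift h) u) hab
  rw [hb, zero_smul, add_zero, map_smul, map_zero] at h1
  have h2 : mfderiv (𝓡 n).tangent 𝓘(ℝ, ℝ) (scalarLift h) u (radialField u) = scalarLift h u :=
    dirDeriv_scalarLift_radialField hh u
  rw [h2] at h1
  exact (smul_eq_zero.1 h1).resolve_right hne

/-- The homogeneity of Vlasov fields: `W` at `t u` is `t` times the image of `W` at `u` under the
fibrewise multiplication by `t`. -/
lemma IsVlasovField.scale_eq [T2Space M] {U : Set (TangentBundle (𝓡 n) M)}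
    {W : VField (𝓡 n).tangent (TangentBundle (𝓡 n) M)} (hW : IsVlasovField U W)
    {u : TangentBundle (𝓡 n) M} {t : ℝ} (hu : u ∈ U) (ht : 0 < t) (htu : scale t u ∈ U) :
    W (scale t u) = t • mfderiv (𝓡 n).tangent (𝓡 n).tangent (scale t) u (W u) := by
  have hm := ((contMDiff_scale_left (n := n) (M := M) t).mdifferentiable (by simp) u).hasMFDerivAt
  rw [← sub_eq_zero]
  -- Both sides project to tu, so their difference is vertical. On a scalar lift both give t² times
  -- the value at u: one factor t is explicit, the other is the linearity of the lift on fibres.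
  apply eq_zero_of_dirDeriv_scalarLift
  · have hπ : MDifferentiable (𝓡 n).tangent (𝓡 n)
        (Bundle.TotalSpace.proj : TangentBundle (𝓡 n) M → M) :=
      (Bundle.contMDiff_proj (TangentSpace (𝓡 n) : M → Type _) (n := 1)).mdifferentiable
        (by simp)
    have h1 := (hπ (scale t u)).hasMFDerivAt.comp u hm
    have h2 := DFunLike.congr_fun (hasMFDerivAt_unique h1 (hπ u).hasMFDerivAt) (W u)
    have h2' : mfderiv (𝓡 n).tangent (𝓡 n) (Bundle.TotalSpace.proj : TangentBundle (𝓡 n) M → M)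
        (scale t u) (mfderiv (𝓡 n).tangent (𝓡 n).tangent (scale t) u (W u)) = u.snd :=
      h2.trans (hW.horizontal u hu)
    rw [map_sub, map_smul, h2', hW.horizontal _ htu]
    exact sub_self (t • u.snd)
  · intro h hh
    have hd := (contMDiff_scalarLift hh).mdifferentiable (by simp)
    have h1 := (hd (scale t u)).hasMFDerivAt.comp u hm
    have h3 : HasMFDerivAt (𝓡 n).tangent 𝓘(ℝ, ℝ) (fun w => t * scalarLift h w) u
        (t • mfderiv (𝓡 n).tangent 𝓘(ℝ, ℝ) (scalarLift h) u) :=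
      (hd u).hasMFDerivAt.const_smul t
    have h2 := DFunLike.congr_fun (hasMFDerivAt_unique h1 (h3.congr_of_eventuallyEq
      (Filter.Eventually.of_forall fun w => scalarLift_scale h t w))) (W u)
    have h2' : dirDeriv (scalarLift h) (scale t u)
        (mfderiv (𝓡 n).tangent (𝓡 n).tangent (scale t) u (W u)) =
        t * dirDeriv (scalarLift h) u (W u) := h2
    rw [dirDeriv_sub_smul, h2', hW.quadratic h hh u hu t ht]
    ring

end Radial

/-! ### Topology of the time orientation -/

section Orientation

variable {n : ℕ} {M : Type*} [TopologicalSpace M]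
  [ChartedSpace (EuclideanSpace ℝ (Fin n)) M] [IsManifold (𝓡 n) ∞ M]
  {U Up Um : Set (TangentBundle (𝓡 n) M)}

namespace IsTimeOrientation

/-- A continuous function with values ±1 is locally constant, so U⁺ is relatively open in U.
Pullback and zero form can therefore be treated separately. -/
lemma future_mem_nhdsWithin (hor : IsTimeOrientation U Up Um) {u : TangentBundle (𝓡 n) M}
    (hu : u ∈ Up) : Up ∈ 𝓝[U] u := by
  have hc := hor.smooth_indicator.continuousOn u (hor.union_eq ▸ Or.inl hu)
  have h1 : causalIndicator Up u = 1 := if_pos hu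
  have := hc.eventually (lt_mem_nhds (show (0 : ℝ) < causalIndicator Up u by rw [h1]; norm_num))
  filter_upwards [this] with w hw
  by_contra hn
  rw [causalIndicator, if_neg hn] at hw
  norm_num at hw

lemma past_mem_nhdsWithin (hor : IsTimeOrientation U Up Um) {u : TangentBundle (𝓡 n) M}
    (hu : u ∈ Um) : Um ∈ 𝓝[U] u := by
  have hc := hor.smooth_indicator.continuousOn u (hor.union_eq ▸ Or.inr hu)
  have h1 : causalIndicator Up u = -1 := if_neg fun h => hor.disj.notMem_of_mem_left h hu
  have := hc.eventually (gt_mem_nhds (show causalIndicator Up u < (0 : ℝ) by rw [h1]; norm_num))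
  filter_upwards [this, self_mem_nhdsWithin] with w hw hwU
  rw [hor.union_eq] at hwU
  refine hwU.resolve_left fun hn => ?_
  rw [causalIndicator, if_pos hn] at hw
  norm_num at hw

/-- The open ray through u is connected and stays in U. Leaving U⁺ would force the indicator to take
the value 0 on it. -/
lemma scale_mem_future (hor : IsTimeOrientation U Up Um) (hU : IsConicSubbundle U)
    {u : TangentBundle (𝓡 n) M} (hu : u ∈ Up) {t : ℝ} (ht : 0 < t) : scale t u ∈ Up := by
  by_contra hn
  have huU : u ∈ U := hor.union_eq ▸ Or.inl hu
  have hc : ContinuousOn (fun s : ℝ => causalIndicator Up (scale s u)) (Ioi 0) :=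
    hor.smooth_indicator.continuousOn.comp (contMDiff_scale_right u).continuous.continuousOn
      fun s hs => hU.conic u huU s (ne_of_gt hs)
  have h1 : causalIndicator Up (scale 1 u) = 1 := if_pos (by rwa [scale_one])
  have h2 : causalIndicator Up (scale t u) = -1 := if_neg hn
  obtain ⟨s, -, hs⟩ := isPreconnected_Ioi.intermediate_value (mem_Ioi.2 ht)
    (mem_Ioi.2 (zero_lt_one (α := ℝ))) hc
    (show (0 : ℝ) ∈ Icc (causalIndicator Up (scale t u)) (causalIndicator Up (scale 1 u)) by
      rw [h1, h2]; norm_num)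
  simp only [causalIndicator] at hs
  split_ifs at hs <;> norm_num at hs

lemma eventuallyEq_future (hor : IsTimeOrientation U Up Um) {u : TangentBundle (𝓡 n) M}
    (hu : u ∈ Up) : U =ᶠ[𝓝 u] Up := by
  have h := hor.future_mem_nhdsWithin hu
  rw [mem_nhdsWithin_iff_eventually] at h
  filter_upwards [h] with w hw
  exact propext ⟨hw, fun h => hor.union_eq ▸ Or.inl h⟩

lemma uniqueMDiffOn_future (hor : IsTimeOrientation U Up Um) (hU : IsConicSubbundle U) :
    UniqueMDiffOn (𝓡 n).tangent Up := by
  intro u hu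
  have huU : u ∈ U := hor.union_eq ▸ Or.inl hu
  exact ((hU.uniqueDiff u huU).inter' (hor.future_mem_nhdsWithin hu)).mono inter_subset_right

lemma future_subset_closure_interior (hor : IsTimeOrientation U Up Um) (hU : IsConicSubbundle U) :
    Up ⊆ closure (interior Up) := by
  intro u hu
  have huU : u ∈ U := hor.union_eq ▸ Or.inl hu
  obtain ⟨O, hO, huO, hOU⟩ := mem_nhdsWithin.1 (hor.future_mem_nhdsWithin hu)
  rw [mem_closure_iff]
  intro O' hO' huO'
  obtain ⟨w, hw1, hw2⟩ := mem_closure_iff.1 (hU.subset_closure_interior huU) _ (hO'.inter hO)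
    ⟨huO', huO⟩
  exact ⟨w, hw1.1, mem_interior.2 ⟨O ∩ interior U,
    fun z hz => hOU ⟨hz.1, interior_subset hz.2⟩, hO.inter isOpen_interior, hw1.2, hw2⟩⟩

end IsTimeOrientation

end Orientation

/-! ### The radial projection and the form it pulls back -/

section KinematicDomain

variable {n : ℕ} {M : Type*} [TopologicalSpace M]
  [ChartedSpace (EuclideanSpace ℝ (Fin n)) M] [IsManifold (𝓡 n) ∞ M]
  {U Up Um : Set (TangentBundle (𝓡 n) M)}
  {H : Type*} [TopologicalSpace H]
  {J : ModelWithCorners ℝ (EuclideanSpace ℝ (Fin (2 * n - 1))) H}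
  {E : Type*} [TopologicalSpace E] [ChartedSpace H E] [Nonempty E]
  {ιE : E → TangentBundle (𝓡 n) M}

namespace IsKinematicDomain

-- The ray condition gives some t ≠ 0. If t < 0, then u is the negative of the future vector -t v,
-- so it lies in U⁻.
omit [Nonempty E] in
lemma exists_pos_scale (hE : IsKinematicDomain J U Up ιE) (hor : IsTimeOrientation U Up Um)
    (hU : IsConicSubbundle U) {u : TangentBundle (𝓡 n) M} (hu : u ∈ Up) :
    ∃ v : E, ∃ t : ℝ, 0 < t ∧ u = scale t (ιE v) := by
  obtain ⟨⟨v, t⟩, ⟨ht, hut⟩, -⟩ := hE.ray u (hor.union_eq ▸ Or.inl hu)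
  refine ⟨v, t, ?_, hut⟩
  by_contra hneg
  have ht' : 0 < -t := neg_pos.2 (lt_of_le_of_ne (not_lt.1 hneg) ht)
  have h1 := (hor.neg_iff _).1 (hor.scale_mem_future hU (hE.mem_future v) ht')
  rw [scale_scale, neg_mul_neg, one_mul] at h1
  exact hor.disj.notMem_of_mem_left hu (hut ▸ h1)

lemma radialProj_scale (hE : IsKinematicDomain J U Up ιE) (hor : IsTimeOrientation U Up Um)
    (hU : IsConicSubbundle U) (v : E) {t : ℝ} (ht : 0 < t) :
    radialProj ιE (scale t (ιE v)) = v := by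
  obtain ⟨s, hs, hst⟩ := Classical.epsilon_spec
    (p := fun v' => ∃ s : ℝ, 0 < s ∧ scale t (ιE v) = scale s (ιE v')) ⟨v, t, ht, rfl⟩
  have hmem : scale t (ιE v) ∈ U := by
    rw [hor.union_eq]
    exact Or.inl (hor.scale_mem_future hU (hE.mem_future v) ht)
  have := (hE.ray _ hmem).unique (y₁ := (v, t))
    (y₂ := (radialProj ιE (scale t (ιE v)), s)) ⟨ht.ne', rfl⟩ ⟨hs.ne', hst⟩
  exact (congrArg Prod.fst this).symm

lemma radialProj_scale_of_mem (hE : IsKinematicDomain J U Up ιE) (hor : IsTimeOrientation U Up Um)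
    (hU : IsConicSubbundle U) {u : TangentBundle (𝓡 n) M} (hu : u ∈ Up) {t : ℝ} (ht : 0 < t) :
    radialProj ιE (scale t u) = radialProj ιE u := by
  obtain ⟨v, s, hs, rfl⟩ := hE.exists_pos_scale hor hU hu
  rw [scale_scale, hE.radialProj_scale hor hU v (mul_pos ht hs), hE.radialProj_scale hor hU v hs]

/-- At s = 1 the s-derivative of F(sz) at a point of E is R⟨F⟩ ≠ 0, so there is a smooth σ near that
point with F(σ(z) z) = 0. As U is conic, σ(z) z lies in E for z in U⁺, and uniqueness on rays makes
it the projection of z. The embedding then turns smoothness into TM into smoothness into E. -/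
lemma contMDiffWithinAt_radialProj (hE : IsKinematicDomain J U Up ιE)
    (hor : IsTimeOrientation U Up Um) (hU : IsConicSubbundle U) (v : E) :
    ContMDiffWithinAt (𝓡 n).tangent J ∞ (radialProj ιE) Up (ιE v) := by
  obtain ⟨O, hO, hvO, F, hF, hFO, hdF⟩ := hE.hypersurface v
  have hFv : F (ιE v) = 0 := by
    have : ιE v ∈ {u ∈ U ∩ O | F u = 0} := hFO ▸ ⟨mem_range_self v, hvO⟩
    exact this.2
  have hFat : ContMDiffAt (𝓡 n).tangent 𝓘(ℝ, ℝ) ∞ F (ιE v) := hF.contMDiffAt (hO.mem_nhds hvO)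
  have hswap : ContMDiff ((𝓡 n).tangent.prod 𝓘(ℝ, ℝ)) (𝓡 n).tangent ∞
      (fun q : TangentBundle (𝓡 n) M × ℝ => scale q.2 q.1) :=
    contMDiff_scale.comp (contMDiff_snd.prodMk contMDiff_fst)
  have hf : ContMDiffAt ((𝓡 n).tangent.prod 𝓘(ℝ, ℝ)) 𝓘(ℝ, ℝ) ∞
      (fun q : TangentBundle (𝓡 n) M × ℝ => F (scale q.2 q.1)) (ιE v, 1) :=
    ContMDiffAt.comp_of_eq (g := F) (f := fun q : TangentBundle (𝓡 n) M × ℝ => scale q.2 q.1)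
      hFat (hswap _) (scale_one _)
  have hd : deriv (fun t => F (scale t (ιE v))) 1 ≠ 0 := by
    rw [(hasDerivAt_comp_scale (hFat.mdifferentiableAt (by simp))).deriv]
    exact hdF
  obtain ⟨σ, hσ, hσ1, hσF⟩ := exists_implicit_scalar hf hd
  have hscale : ContMDiffAt (𝓡 n).tangent (𝓡 n).tangent ∞ (fun z => scale (σ z) z) (ιE v) :=
    ContMDiffAt.comp (ιE v) (g := fun q : ℝ × TangentBundle (𝓡 n) M => scale q.1 q.2)
      (contMDiff_scale _) (hσ.prodMk contMDiffAt_id)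
  have hbase : scale (σ (ιE v)) (ιE v) = ιE v := by rw [hσ1, scale_one]
  have hev : ∀ᶠ z in 𝓝[Up] (ιE v), ιE (radialProj ιE z) = scale (σ z) z := by
    have hpos : ∀ᶠ z in 𝓝 (ιE v), 0 < σ z :=
      hσ.continuousAt.eventually (lt_mem_nhds (by rw [hσ1]; norm_num))
    have hin : ∀ᶠ z in 𝓝 (ιE v), scale (σ z) z ∈ O :=
      hscale.continuousAt.eventually (hO.mem_nhds (by simpa only [hbase] using hvO))
    filter_upwards [mem_nhdsWithin_of_mem_nhds hpos, mem_nhdsWithin_of_mem_nhds hin,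
      mem_nhdsWithin_of_mem_nhds hσF, self_mem_nhdsWithin] with z hz1 hz2 hz3 hz4
    have hz1 : 0 < σ z := hz1
    have hz3 : F (scale (σ z) z) = 0 := by
      have : F (scale (σ z) z) = F (scale 1 (ιE v)) := hz3
      rw [this, scale_one, hFv]
    have hzU : z ∈ U := hor.union_eq ▸ Or.inl hz4
    have hmem : scale (σ z) z ∈ range ιE ∩ O := by
      rw [hFO]
      exact ⟨⟨hU.conic z hzU _ hz1.ne', hz2⟩, hz3⟩
    obtain ⟨v', hv'⟩ := hmem.1
    have h1 := hE.radialProj_scale hor hU v' one_pos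
    rw [scale_one, hv', hE.radialProj_scale_of_mem hor hU hz4 hz1] at h1
    rw [h1, hv']
  have hpt : ιE (radialProj ιE (ιE v)) = scale (σ (ιE v)) (ιE v) := by
    have h1 := hE.radialProj_scale hor hU v one_pos
    rw [scale_one] at h1
    rw [h1, hbase]
  have hcomp : ContMDiffWithinAt (𝓡 n).tangent (𝓡 n).tangent ∞ (ιE ∘ radialProj ιE) Up (ιE v) :=
    hscale.contMDiffWithinAt.congr_of_eventuallyEq hev hpt
  refine contMDiffWithinAt_of_comp_isImmersionAt (hE.embedding.isImmersion.isImmersionAt _)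
    (hE.mem_future v) ?_ hcomp
  exact hE.embedding.isEmbedding.isInducing.continuousWithinAt_iff.2 hcomp.continuousWithinAt

/-- The radial projection onto a kinematic domain is smooth. -/
lemma contMDiffOn_radialProj (hE : IsKinematicDomain J U Up ιE)
    (hor : IsTimeOrientation U Up Um) (hU : IsConicSubbundle U) :
    ContMDiffOn (𝓡 n).tangent J ∞ (radialProj ιE) Up := by
  intro u hu
  obtain ⟨v, t, ht, rfl⟩ := hE.exists_pos_scale hor hU hu
  have hinv : scale t⁻¹ (scale t (ιE v)) = ιE v := by
    rw [scale_scale, inv_mul_cancel₀ ht.ne', scale_one]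
  -- On U⁺ the projection is unchanged by precomposition with multiplication by t⁻¹, which moves the
  -- point onto E.
  have h1 := hE.contMDiffWithinAt_radialProj hor hU v
  rw [← hinv] at h1
  have h2 := h1.comp (scale t (ιE v)) (contMDiff_scale_left t⁻¹).contMDiffAt.contMDiffWithinAt
    (fun w hw => hor.scale_mem_future hU hw (inv_pos.2 ht))
  exact h2.congr (fun w hw => (hE.radialProj_scale_of_mem hor hU hw (inv_pos.2 ht)).symm)
    (hE.radialProj_scale_of_mem hor hU hu (inv_pos.2 ht)).symm

/-- The radial field is annihilated by the derivative of the radial projection. -/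
lemma mfderivWithin_radialProj_radialField (hE : IsKinematicDomain J U Up ιE)
    (hor : IsTimeOrientation U Up Um) (hU : IsConicSubbundle U) {u : TangentBundle (𝓡 n) M}
    (hu : u ∈ Up) :
    mfderivWithin (𝓡 n).tangent J (radialProj ιE) Up u (radialField u) = 0 := by
  have hproj := ((hE.contMDiffOn_radialProj hor hU u hu).mdifferentiableWithinAt
    (by simp)).hasMFDerivWithinAt
  have h := hasMFDerivWithinAt_comp_scale (T := Ioi 0) hproj
    (fun t ht => hor.scale_mem_future hU hu ht)
  have h1 := h.hasMFDerivAt (Ioi_mem_nhds one_pos)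
  -- The projection is constant along the positive ray.
  have h2 : HasMFDerivAt 𝓘(ℝ, ℝ) J (fun t : ℝ => radialProj ιE (scale t u)) 1 0 :=
    (hasMFDerivAt_const (I := 𝓘(ℝ, ℝ)) (radialProj ιE u) (1 : ℝ)).congr_of_eventuallyEq (by
      filter_upwards [Ioi_mem_nhds (zero_lt_one (α := ℝ))] with t ht
      exact hE.radialProj_scale_of_mem hor hU hu ht)
  exact DFunLike.congr_fun (hasMFDerivAt_unique h1 h2) (1 : ℝ)

/-- The derivative of the radial projection maps an extension of `WE` to a multiple of `WE`. -/
lemma mfderivWithin_radialProj_extension [T2Space M] [IsManifold J ∞ E]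
    (hE : IsKinematicDomain J U Up ιE)
    (hor : IsTimeOrientation U Up Um) (hU : IsConicSubbundle U) {WE : VField J E}
    {W : VField (𝓡 n).tangent (TangentBundle (𝓡 n) M)} (hW : IsExtension U ιE WE W)
    (v : E) {t : ℝ} (ht : 0 < t) :
    (mfderivWithin (𝓡 n).tangent J (radialProj ιE) Up (scale t (ιE v)) (W (scale t (ιE v))) :
      EuclideanSpace ℝ (Fin (2 * n - 1))) = t • (WE v : EuclideanSpace ℝ (Fin (2 * n - 1))) := by
  have hv := hE.mem_future v
  have htv := hor.scale_mem_future hU hv ht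
  have hsub : Up ⊆ U := fun w hw => hor.union_eq ▸ Or.inl hw
  have hι := (hE.embedding.contMDiff.mdifferentiable (by simp) v).hasMFDerivAt
  have hm := ((contMDiff_scale_left (n := n) (M := M) t).mdifferentiable
    (by simp) (ιE v)).hasMFDerivAt
  have hproj := ((hE.contMDiffOn_radialProj hor hU _ htv).mdifferentiableWithinAt
    (by simp)).hasMFDerivWithinAt
  have h1 := hproj.comp v (hm.comp v hι).hasMFDerivWithinAt (s := univ)
    (fun w _ => hor.scale_mem_future hU (hE.mem_future w) ht)
  rw [hasMFDerivWithinAt_univ] at h1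
  -- Π ∘ (multiplication by t) ∘ ιE is the identity of `E`, so the composite of the three
  -- derivatives is too.
  have h2 := (hasMFDerivAt_id (I := J) v).congr_of_eventuallyEq
    (f₁ := radialProj ιE ∘ scale t ∘ ιE)
    (Filter.Eventually.of_forall fun w => hE.radialProj_scale hor hU w ht)
  have h3 := DFunLike.congr_fun (hasMFDerivAt_unique h1 h2) (WE v)
  have h4 := hW.vlasov.scale_eq (hsub hv) ht (hsub htv)
  rw [h4, map_smul, ← hW.induced v]
  exact congrArg (fun x : EuclideanSpace ℝ (Fin (2 * n - 1)) => t • x) h3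

end IsKinematicDomain

lemma futureForm_of_mem {k : ℕ} (θE : DForm J E k) {u : TangentBundle (𝓡 n) M} (hu : u ∈ Up) :
    futureForm Up ιE θE u = pullbackForm (𝓡 n).tangent Up (radialProj ιE) θE u :=
  if_pos hu

lemma futureForm_of_notMem {k : ℕ} (θE : DForm J E k) {u : TangentBundle (𝓡 n) M} (hu : u ∉ Up) :
    futureForm Up ιE θE u = 0 :=
  if_neg hu

variable [IsManifold J ∞ E]

lemma smoothForm_futureForm (hE : IsKinematicDomain J U Up ιE)
    (hor : IsTimeOrientation U Up Um) (hU : IsConicSubbundle U) {k : ℕ} {θE : DForm J E k}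
    (hθ : SmoothForm J univ θE) : SmoothForm (𝓡 n).tangent U (futureForm Up ιE θE) := by
  refine smoothForm_of_locally fun u hu => ?_
  rw [hor.union_eq] at hu
  rcases hu with hu | hu
  · exact ⟨Up, hor.future_mem_nhdsWithin hu, _, smoothForm_pullbackForm
      (hor.uniqueMDiffOn_future hU) (hE.contMDiffOn_radialProj hor hU) hθ,
      fun z hz => futureForm_of_mem θE hz⟩
  · exact ⟨Um, hor.past_mem_nhdsWithin hu, _, smoothForm_zero Um k,
      fun z hz => futureForm_of_notMem θE fun h => hor.disj.notMem_of_mem_left h hz⟩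

lemma extD_futureForm (hE : IsKinematicDomain J U Up ιE)
    (hor : IsTimeOrientation U Up Um) (hU : IsConicSubbundle U) {k : ℕ} {θE : DForm J E k}
    (hθ : SmoothForm J univ θE) (hd : ∀ v, extD J univ θE v = 0) {u : TangentBundle (𝓡 n) M}
    (hu : u ∈ U) : extD (𝓡 n).tangent U (futureForm Up ιE θE) u = 0 := by
  have hu' := hu
  rw [hor.union_eq] at hu'
  rcases hu' with hu' | hu'
  · rw [extD_congr hu (hor.eventuallyEq_future hu')
      (β := pullbackForm (𝓡 n).tangent Up (radialProj ιE) θE)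
      (by filter_upwards [hor.future_mem_nhdsWithin hu'] with z hz
          exact futureForm_of_mem θE hz)]
    exact extD_pullbackForm_eq_zero (hor.uniqueMDiffOn_future hU)
      (hor.future_subset_closure_interior hU) (hE.contMDiffOn_radialProj hor hU) hθ hu' (hd _)
  · rw [extD_congr hu Filter.EventuallyEq.rfl (β := fun _ => 0)
      (by filter_upwards [hor.past_mem_nhdsWithin hu'] with z hz
          exact futureForm_of_notMem θE fun h => hor.disj.notMem_of_mem_left h hz)]
    exact extD_zero U k u

omit [IsManifold J ∞ E] in
lemma interiorProd_radialField_futureForm (hE : IsKinematicDomain J U Up ιE)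
    (hor : IsTimeOrientation U Up Um) (hU : IsConicSubbundle U) {k : ℕ} (θE : DForm J E k)
    (u : TangentBundle (𝓡 n) M) : interiorProd (radialField u) (futureForm Up ιE θE u) = 0 := by
  by_cases hu : u ∈ Up
  · rw [futureForm_of_mem θE hu]
    refine interiorProd_compContinuousLinearMap _ _ _ ?_
    rw [hE.mfderivWithin_radialProj_radialField hor hU hu]
    exact interiorProd_zero_left _
  · rw [futureForm_of_notMem θE hu]
    exact interiorProd_zero_right _

lemma interiorProd_extension_futureForm [T2Space M] (hE : IsKinematicDomain J U Up ιE)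
    (hor : IsTimeOrientation U Up Um) (hU : IsConicSubbundle U) {WE : VField J E}
    {W : VField (𝓡 n).tangent (TangentBundle (𝓡 n) M)} (hW : IsExtension U ιE WE W)
    {k : ℕ} {θE : DForm J E k} (hθ : ∀ v, interiorProd (WE v) (θE v) = 0)
    (u : TangentBundle (𝓡 n) M) : interiorProd (W u) (futureForm Up ιE θE u) = 0 := by
  by_cases hu : u ∈ Up
  · rw [futureForm_of_mem θE hu]
    refine interiorProd_compContinuousLinearMap _ _ _ ?_
    obtain ⟨v, t, ht, rfl⟩ := hE.exists_pos_scale hor hU hu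
    let A : E → EuclideanSpace ℝ (Fin (2 * n - 1)) [⋀^Fin k]→L[ℝ] ℝ := θE
    let B : E → EuclideanSpace ℝ (Fin (2 * n - 1)) := WE
    -- The form is evaluated at the projection of tv, which equals v only propositionally; hence a
    -- statement for every w = v.
    have key : ∀ w : E, w = v → interiorProd (t • B v) (A w) = 0 := by
      rintro w rfl
      have h0 : interiorProd (B w) (A w) = 0 := hθ w
      rw [interiorProd_smul_left, h0, smul_zero]
    have h := key _ (hE.radialProj_scale hor hU v ht)
    have h' : mfderivWithin (𝓡 n).tangent J (radialProj ιE) Up (scale t (ιE v))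
        (W (scale t (ιE v))) = t • B v := hE.mfderivWithin_radialProj_extension hor hU hW v ht
    rw [h']
    exact h
  · rw [futureForm_of_notMem θE hu]
    exact interiorProd_zero_right _

end KinematicDomain

end

end Vlasov

/-! ### The transport equations on U -/

theorem mainTheorem6 {n : ℕ} {M : Type*} [TopologicalSpace M] [T2Space M]
    [SecondCountableTopology M] [ConnectedSpace M]
    [ChartedSpace (EuclideanSpace ℝ (Fin n)) M] [IsManifold (𝓡 n) ∞ M]
    {H : Type*} [TopologicalSpace H]
    (J : ModelWithCorners ℝ (EuclideanSpace ℝ (Fin (2 * n - 1))) H)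
    {E : Type*} [TopologicalSpace E] [ChartedSpace H E] [IsManifold J ∞ E] [Nonempty E]
    (U Up Um : Set (TangentBundle (𝓡 n) M))
    (hU : Vlasov.IsConicSubbundle U) (hor : Vlasov.IsTimeOrientation U Up Um)
    (ιE : E → TangentBundle (𝓡 n) M) (hE : Vlasov.IsKinematicDomain J U Up ιE)
    (WE : Vlasov.VField J E) (hWE : Vlasov.IsVlasovFieldOnE ιE WE)
    (θE : Vlasov.DForm J E (2 * n - 2)) (hθE : Vlasov.TransportOnE WE θE)
    (W : Vlasov.VField (𝓡 n).tangent (TangentBundle (𝓡 n) M))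
    (hW : Vlasov.IsExtension U ιE WE W) :
    Vlasov.TransportOnU U (Vlasov.wedge Vlasov.radialField W) (Vlasov.futureForm Up ιE θE) := by
  refine ⟨⟨⟨_, _, Vlasov.smoothField_radialField U, hW.vlasov.smooth, fun _ _ => rfl⟩,
    W, hW.vlasov, fun _ _ => rfl⟩, Vlasov.smoothForm_futureForm hE hor hU hθE.smooth, ?_,
    fun u hu => Vlasov.extD_futureForm hE hor hU hθE.smooth hθE.closed hu⟩
  rintro X Y ⟨-, -, hXY⟩ u hu
  have hR := Vlasov.interiorProd_radialField_futureForm hE hor hU θE u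
  have hWu := Vlasov.interiorProd_extension_futureForm hE hor hU hW hθE.tangent u
  -- The null condition concerns every factorization of the bivector. Each has its factors in the
  -- plane of R and W, where contraction with θ already vanishes.
  obtain ⟨hX, hY⟩ := Vlasov.mem_span_of_ιMulti_eq
    (Vlasov.linearIndependent_radialField (hU.slit u hu) (hW.vlasov.horizontal u hu)) (hXY u hu)
  exact ⟨Vlasov.interiorProd_eq_zero_of_mem_span hR hWu hX,
    Vlasov.interiorProd_eq_zero_of_mem_span hR hWu hY⟩
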